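/- Let $K$ be a perfect field of characteristic $p>3$, let $f=x_1^3+x_2^3+x_3^3+x_4^3\in K[[x_1,x_2,x_3,x_4]]$ and $R=K[[x_1,x_2,x_3,x_4]]/(f)$. For $e\ge 0$ let $R^{1/p^e}$ be the ring obtained from $R$ by adjoining $p^e$-th roots of all elements of $R$, and let $FS_f(e)$ be the F-signature function of $R$, that is, the maximal rank of a free $R$-module that is a direct summand of the $R$-module $R^{1/p^e}$. Let $s(f)$ be the F-signature of $R$, that is, the real number for which $FS_f(e)=s(f)\,p^{e\dim R}+O(p^{e(\dim R-1)})$ as $e\to\infty$. Put $\alpha=0$ if $p\equiv 1 \bmod 3$ and $\alpha=1$ if $p\equiv 2\bmod 3$. Then $$s(f)=\frac{3p(p-1)(p+1)}{8\left(3p^3-p+2(-1)^{\alpha+1}\right)},$$ and, for every integer $e\geq 1$, $$FS_f(e)=s(f)\,p^{3e}+\left(1-s(f)\right)\left(\frac{p+2(-1)^{\alpha}}{3}\right)^{e}.$$ In particular $s(f)<\frac18$. Hence the answer to the following question of Watanabe and Yoshida is negative for $d=3$ and every prime $p>3$: for an integer $d\ge 2$ and a perfect field of characteristic $p>d$, is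 the F-signature of $K[[x_1,\dots,x_{d+1}]]/(x_1^d+\cdots+x_{d+1}^d)$ equal to $\frac{1}{2^{d-1}(d-1)!}$? -/

import Mathlib

open Filter Asymptotics

/-- The ring `R^{1/p^e}` of `p^e`-th roots of elements of a (reduced) ring `R` of characteristic
`p`, as an `R`-algebra.  Taking `p^e`-th powers is a ring isomorphism `R^{1/p^e} ≃ R` that turns
the inclusion `R ⊆ R^{1/p^e}` into the `e`-th iterate of the Frobenius `R → R`.  So the model used
here is the ring `R` itself, made an `R`-algebra by `r ↦ r ^ (p ^ e)`; an element `x` of this copy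
of `R` stands for `x^{1/p^e}`. -/
def FrobeniusRoot (R : Type*) (_p _e : ℕ) : Type _ := R

namespace FrobeniusRoot

variable (R : Type*) (p e : ℕ)

instance [CommRing R] : CommRing (FrobeniusRoot R p e) := inferInstanceAs (CommRing R)

noncomputable instance [CommRing R] [ExpChar R p] : Algebra R (FrobeniusRoot R p e) :=
  (iterateFrobenius R p e).toAlgebra

/-- The `p^e`-th root of `r`, as an element of `R^{1/p^e}`. -/
def root (r : R) : FrobeniusRoot R p e := r

/-- In `R^{1/p^e}` the element `root r` is a `p^e`-th root of `r`. -/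
theorem root_pow [CommRing R] [ExpChar R p] (r : R) :
    root R p e r ^ p ^ e = algebraMap R (FrobeniusRoot R p e) r := rfl

/-- Every element of `R^{1/p^e}` is a `p^e`-th root of a unique element of `R`. -/
theorem root_bijective : Function.Bijective (root R p e) := Function.bijective_id

/-- For reduced `R`, the ring `R^{1/p^e}` is an extension ring of `R`. -/
theorem algebraMap_injective [CommRing R] [ExpChar R p] [IsReduced R] :
    Function.Injective (algebraMap R (FrobeniusRoot R p e)) :=
  iterateFrobenius_inj R p e

end FrobeniusRoot

/-- `M` has a free direct summand of rank `n`. -/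
def HasFreeSummand (R M : Type*) [CommRing R] [AddCommGroup M] [Module R M] (n : ℕ) : Prop :=
  ∃ P Q : Submodule R M, IsCompl P Q ∧ Nonempty (P ≃ₗ[R] (Fin n → R))

/-- Having a free summand of rank `n` is the same as surjecting onto a free module of rank `n`. -/
theorem hasFreeSummand_iff_exists_surjective (R M : Type*) [CommRing R] [AddCommGroup M]
    [Module R M] (n : ℕ) :
    HasFreeSummand R M n ↔ ∃ g : M →ₗ[R] (Fin n → R), Function.Surjective g := by
  constructor
  · rintro ⟨P, Q, h, ⟨φ⟩⟩
    refine ⟨φ.toLinearMap ∘ₗ P.projectionOnto Q h, ?_⟩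
    simpa using φ.surjective.comp (Submodule.projectionOnto_surjective h)
  · rintro ⟨g, hg⟩
    obtain ⟨s, hs⟩ := Module.projective_lifting_property g LinearMap.id hg
    have hgs : ∀ v, g (s v) = v := fun v => LinearMap.congr_fun hs v
    have hinj : Function.Injective s := Function.LeftInverse.injective hgs
    refine ⟨LinearMap.range s, LinearMap.ker g, ⟨?_, ?_⟩,
      ⟨(LinearEquiv.ofInjective s hinj).symm⟩⟩
    · rw [Submodule.disjoint_def]
      rintro _ ⟨v, rfl⟩ hv
      rw [LinearMap.mem_ker, hgs] at hv
      rw [hv, map_zero]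
    · rw [codisjoint_iff, eq_top_iff]
      intro x _
      refine Submodule.mem_sup.mpr ⟨s (g x), ⟨g x, rfl⟩, x - s (g x), ?_, by abel⟩
      rw [LinearMap.mem_ker, map_sub, hgs, sub_self]

/-- `frk_R(M)`: the maximal rank of a free direct summand of `M`.  (The set of these ranks is
bounded when `R` is nontrivial and `M` is finitely generated.) -/
noncomputable def freeRank (R M : Type*) [CommRing R] [AddCommGroup M] [Module R M] : ℕ :=
  sSup {n : ℕ | HasFreeSummand R M n}

/-- The F-signature function `FS_R(e) = frk_R(R^{1/p^e})` of a ring of characteristic `p`. -/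
noncomputable def FSignatureFunction (p : ℕ) (R : Type*) [CommRing R] [ExpChar R p] (e : ℕ) : ℕ :=
  freeRank R (FrobeniusRoot R p e)

/-- `s` is the F-signature of `R`: `R` has finite Krull dimension `d` and
`FS_R(e) = s * p^(d e) + O(p^((d-1) e))` as `e → ∞`. -/
def HasFSignature (p : ℕ) (R : Type*) [CommRing R] [ExpChar R p] (s : ℝ) : Prop :=
  ∃ d : ℕ, ringKrullDim R = d ∧
    (fun e : ℕ => (FSignatureFunction p R e : ℝ) - s * (p : ℝ) ^ (d * e)) =O[atTop]
      (fun e : ℕ => (p : ℝ) ^ (((d : ℤ) - 1) * (e : ℤ)))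

/-- The F-signature is unique. -/
theorem HasFSignature.unique {p : ℕ} (hp : 1 < p) {R : Type*} [CommRing R] [ExpChar R p]
    {s t : ℝ} (hs : HasFSignature p R s) (ht : HasFSignature p R t) : s = t := by
  obtain ⟨d, hd, hs⟩ := hs
  obtain ⟨d', hd', ht⟩ := ht
  obtain rfl : d = d' := by
    rw [hd] at hd'
    exact_mod_cast hd'
  have hp0 : (p : ℝ) ≠ 0 := by positivity
  have hp1 : (1 : ℝ) < p := by exact_mod_cast hp
  have h := (ht.sub hs).mul (isBigO_refl (fun e : ℕ => ((p : ℝ) ^ (d * e))⁻¹) atTop)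
  have h1 : (fun e : ℕ => s - t) =O[atTop] (fun e : ℕ => ((p : ℝ)⁻¹) ^ e) := by
    refine h.congr (fun e => ?_) (fun e => ?_)
    · field_simp
      ring
    · rw [← zpow_natCast (p : ℝ) (d * e), ← zpow_neg, ← zpow_add₀ hp0, inv_pow,
        ← zpow_natCast (p : ℝ) e, ← zpow_neg]
      congr 1
      push_cast
      ring
  have h2 := h1.trans_tendsto
    (tendsto_pow_atTop_nhds_zero_of_lt_one (by positivity) (inv_lt_one_of_one_lt₀ hp1))
  exact sub_eq_zero.mp (tendsto_nhds_unique tendsto_const_nhds h2)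

/-- The Fermat cubic `x₁³ + x₂³ + x₃³ + x₄³` in `K⟦x₁, x₂, x₃, x₄⟧`. -/
noncomputable def fermatCubic (K : Type*) [Field K] : MvPowerSeries (Fin 4) K :=
  ∑ i, MvPowerSeries.X i ^ 3

/-- The hypersurface ring `K⟦x₁, x₂, x₃, x₄⟧ / (x₁³ + x₂³ + x₃³ + x₄³)`. -/
abbrev FermatCubicRing (K : Type*) [Field K] : Type _ :=
  MvPowerSeries (Fin 4) K ⧸ Ideal.span {fermatCubic K}

instance (K : Type*) [Field K] : Nontrivial (FermatCubicRing K) := by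
  rw [Ideal.Quotient.nontrivial_iff, Ne, Ideal.span_singleton_eq_top,
    MvPowerSeries.isUnit_iff_constantCoeff]
  simp [fermatCubic]

instance (K : Type*) [Field K] (p : ℕ) [CharP K p] : CharP (FermatCubicRing K) p :=
  charP_of_injective_algebraMap (algebraMap K (FermatCubicRing K)).injective p

/-! Write q = p^e, g = x^3 + y^3, and let N_q(t) be the number of Jordan blocks of size larger than
t of multiplication by g on K[x,y]/(x^q,y^q).

By an argument in the style of Fedder, every R-linear map R^{1/q} → R comes from multiplication by
f^(q-1)h followed by projection to the component of the top monomial. A free summand of rank n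
therefore amounts to series h_i, r_j for which f^(q-1) h_i r_j has coefficient δ_ij at the monomial
with all exponents q-1 (`hasFreeSummand_frobeniusRoot_iff`). That coefficient defines a perfect
pairing on K[x₁,…,x₄]/(x_i^q), so the largest n is the rank of multiplication by f^(q-1) on this
algebra (`exists_dual_system_fermatCubic_iff`).

Since f = g(x₁,x₂) + g(x₃,x₄), in characteristic p the power f^(q-1) is the alternating sum of g^s ⊗
g^(q-1-s). A pair of Jordan blocks of sizes c and d contributes max(c+d-q, 0) to its rank, and in
total F(q) = ∑ N_q(t) N_q(q-1-t) (`finrank_range_alternatingTensor`).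

It remains to pass from N_q to N_(pq). The ideals (x^p,y^p) : g^t are generated by explicit pairs of
forms, built upwards in degree: the pairs satisfy a first-order differential system, which in degree
p forces all partial derivatives to vanish, so the last pair spans the same space as x^p, y^p
(`span_fermatPair_eq`). Substituting x^q, y^q gives the ideals (x^(pq),y^(pq)) : g^(qt). Modulo g^q
the generators of these ideals are proportional to simple pairs, so their colengths are computable.
On even strips of length q, N_(pq) is a translate of N_q; on odd strips it is a constant minus the
reversal of N_q; beyond 2m+1 strips it is zero (`planeCount_even`, `planeCount_odd`,
`planeCount_eq_zero`).

Pairing complementary indices and using ∑ N_q = q^2 yields F(pq) = λ F(q) + q^3 (p^3 - p)/8, where λ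
= m + 2 - d₀ = (p ± 2)/3 is the number of strips for which both factors survive
(`planeConvolution_mul_p`). With F(1) = 1 this linear recursion gives the closed formula, and λ ≤
p^2 gives the error term. -/

/-! ### Jordan chains. -/

open Polynomial in
/-- Jordan chains of a nilpotent endomorphism. -/
theorem exists_basis_jordan_chains {K W : Type*} [Field K] [AddCommGroup W] [Module K W]
    [FiniteDimensional K W] (T : Module.End K W) (q : ℕ) (hT : T ^ q = 0) :
    ∃ (m : ℕ) (k : Fin m → ℕ) (v : Fin m → W) (b : Module.Basis (Σ i, Fin (k i)) K W),
      (∀ i, (T ^ k i) (v i) = 0) ∧ ∀ x, b x = (T ^ (x.2 : ℕ)) (v x.1) := by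
  have htors : Module.IsTorsion' (Module.AEval' T) (Submonoid.powers (X : K[X])) := by
    intro w
    refine ⟨⟨X ^ q, q, rfl⟩, ?_⟩
    obtain ⟨w, rfl⟩ := (Module.AEval'.of T).surjective w
    change (X ^ q : K[X]) • Module.AEval'.of T w = 0
    rw [Module.AEval'.X_pow_smul_of, hT]
    simp
  obtain ⟨m, k, ⟨e⟩⟩ := Module.torsion_by_prime_power_decomposition
    (irreducible_X (R := K)) htors
  classical
  let B : ∀ i, Module.Basis (Fin (k i)) K (K[X] ⧸ Submodule.span K[X] {(X : K[X]) ^ (k i)}) :=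
    fun i => ((AdjoinRoot.powerBasis' (monic_X_pow (k i))).basis.reindex
      (finCongr (by simp)) : Module.Basis (Fin (k i)) K (AdjoinRoot ((X : K[X]) ^ k i)))
  have hB : ∀ i a, B i a = (X ^ (a : ℕ) : K[X]) • Submodule.Quotient.mk (1 : K[X]) := by
    intro i a
    have h : ((AdjoinRoot.powerBasis' (monic_X_pow (R := K) (k i))).basis.reindex
        (finCongr (by simp))) a = AdjoinRoot.mk ((X : K[X]) ^ k i) (X ^ (a : ℕ)) := by
      rw [Module.Basis.reindex_apply, PowerBasis.basis_eq_pow, map_pow]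
      rfl
    refine h.trans ?_
    rw [← Submodule.Quotient.mk_smul, smul_eq_mul, mul_one]
    rfl
  let b0 : Module.Basis (Σ i, Fin (k i)) K
      (DirectSum (Fin m) fun i => K[X] ⧸ Submodule.span K[X] {(X : K[X]) ^ (k i)}) :=
    DFinsupp.basis B
  have hb0 : ∀ x, b0 x = (X ^ (x.2 : ℕ) : K[X]) •
      DirectSum.lof K[X] (Fin m) (fun i => K[X] ⧸ Submodule.span K[X] {(X : K[X]) ^ (k i)}) x.1
        (Submodule.Quotient.mk (1 : K[X])) := by
    intro x
    have h : b0 x = DFinsupp.single x.1 (B x.1 x.2) := by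
      rw [Module.Basis.apply_eq_iff]
      change (sigmaFinsuppLequivDFinsupp K).symm (DFinsupp.mapRange.linearEquiv
        (fun i => (B i).repr) (DFinsupp.single x.1 (B x.1 x.2))) = _
      rw [DFinsupp.mapRange.linearEquiv_apply, DFinsupp.mapRange_single]
      simp only [Module.Basis.repr_self]
      rw [LinearEquiv.symm_apply_eq]
      exact (sigmaFinsuppEquivDFinsupp_single x 1).symm
    rw [h, hB, ← map_smul]
    rfl
  have hpow : ∀ (n : ℕ) (w : Module.AEval' T), (Module.AEval'.of T).symm ((X ^ n : K[X]) • w) =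
      (T ^ n) ((Module.AEval'.of T).symm w) := by
    intro n w
    obtain ⟨w, rfl⟩ := (Module.AEval'.of T).surjective w
    rw [Module.AEval'.X_pow_smul_of]
    rfl
  let e' := (e.restrictScalars K).symm.trans (Module.AEval'.of T).symm
  refine ⟨m, k, fun i => (Module.AEval'.of T).symm (e.symm (DirectSum.lof K[X] (Fin m) _ i
    (Submodule.Quotient.mk (1 : K[X])))), b0.map e', ?_, ?_⟩
  · intro i
    rw [← hpow, ← map_smul, ← map_smul, ← Submodule.Quotient.mk_smul,
      (Submodule.Quotient.mk_eq_zero _).mpr]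
    · simp
    · rw [smul_eq_mul, mul_one]
      exact Submodule.mem_span_singleton_self _
  · intro x
    rw [Module.Basis.map_apply, hb0, ← hpow, ← map_smul e.symm]
    rfl

/-! ### Rank of the alternating tensor sum in terms of Jordan blocks. -/

section KroneckerRank

open TensorProduct

variable {K W : Type*} [Field K] [AddCommGroup W] [Module K W]

/-- The alternating sum `∑ (-1)^s T^s ⊗ T^(q-1-s)`, which is `(T ⊗ 1 + 1 ⊗ T)^(q-1)` when `q` is a
power of the characteristic. -/
noncomputable def alternatingTensor (T : Module.End K W) (q : ℕ) : Module.End K (W ⊗[K] W) :=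
  ∑ s ∈ Finset.range q, (-1 : K) ^ s • TensorProduct.map (T ^ s) (T ^ (q - 1 - s))

/-- The alternating sum of `T^c v ⊗ T^d w` over `c + d = n`. -/
noncomputable def alternatingChain (T : Module.End K W) (v w : W) (n : ℕ) : W ⊗[K] W :=
  ∑ c ∈ Finset.range (n + 1), (-1 : K) ^ c • ((T ^ c) v ⊗ₜ[K] (T ^ (n - c)) w)

theorem pow_apply_eq_zero_of_le {T : Module.End K W} {v : W} {k n : ℕ} (h : (T ^ k) v = 0)
    (hkn : k ≤ n) : (T ^ n) v = 0 := by
  rw [← Nat.sub_add_cancel hkn, pow_add, Module.End.mul_apply, h, map_zero]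

/-- After the shift c = a + s, the terms of the chain outside the window a ≤ c < a + q contain a
power of T of exponent at least q and vanish. Up to sign the image thus depends only on a + b. -/
theorem alternatingTensor_tmul {T : Module.End K W} {q : ℕ} (hT : T ^ q = 0) (v w : W) (a b : ℕ) :
    alternatingTensor T q ((T ^ a) v ⊗ₜ (T ^ b) w) =
      (-1 : K) ^ a • alternatingChain T v w (a + b + q - 1) := by
  have h0 : ∀ (u : W), (T ^ q) u = 0 := fun u => by rw [hT]; rfl
  rcases Nat.eq_zero_or_pos q with rfl | hq
  · have hz : ∀ u : W, u = 0 := fun u => by simpa using h0 u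
    rw [hz v]
    simp [alternatingTensor, alternatingChain]
  rw [alternatingTensor, alternatingChain, LinearMap.sum_apply, Finset.smul_sum]
  have hsub : (Finset.range q).map (addLeftEmbedding a) ⊆ Finset.range (a + b + q - 1 + 1) := by
    intro x hx
    simp only [Finset.mem_map, Finset.mem_range, addLeftEmbedding_apply] at hx ⊢
    omega
  rw [← Finset.sum_subset hsub, Finset.sum_map]
  · refine Finset.sum_congr rfl fun s hs => ?_
    rw [Finset.mem_range] at hs
    rw [LinearMap.smul_apply, TensorProduct.map_tmul, addLeftEmbedding_apply, smul_smul,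
      ← pow_add, ← Module.End.mul_apply, ← Module.End.mul_apply, ← pow_add, ← pow_add,
      add_comm s a, show q - 1 - s + b = a + b + q - 1 - (a + s) by omega, ← add_assoc, pow_add _ (a + a), ← two_mul, pow_mul]
    simp
  · intro c hc hc'
    simp only [Finset.mem_map, Finset.mem_range, addLeftEmbedding_apply, not_exists, not_and]
      at hc hc'
    rcases lt_or_ge c a with h | h
    · rw [pow_apply_eq_zero_of_le (h0 w) (n := a + b + q - 1 - c) (by omega)]
      simp
    · rw [pow_apply_eq_zero_of_le (h0 v) (n := c)]
      · simp
      · by_contra hcq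
        exact hc' (c - a) (by omega) (by omega)

theorem finrank_range_pow_eq_card [FiniteDimensional K W] {T : Module.End K W} {m : ℕ}
    {k : Fin m → ℕ} {v : Fin m → W} (b : Module.Basis (Σ i, Fin (k i)) K W)
    (hv : ∀ i, (T ^ k i) (v i) = 0) (hb : ∀ x, b x = (T ^ (x.2 : ℕ)) (v x.1)) (t : ℕ) :
    Module.finrank K (LinearMap.range (T ^ t)) = ∑ i, (k i - t) := by
  classical
  have hrange : LinearMap.range (T ^ t) =
      Submodule.span K (Set.range fun x : {x : Σ i, Fin (k i) // t ≤ (x.2 : ℕ)} => b x) := by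
    apply le_antisymm
    · rw [LinearMap.range_eq_map, ← b.span_eq, Submodule.map_span, Submodule.span_le]
      rintro _ ⟨_, ⟨x, rfl⟩, rfl⟩
      rw [hb, ← Module.End.mul_apply, ← pow_add]
      by_cases h : t + x.2 < k x.1
      · exact Submodule.subset_span ⟨⟨⟨x.1, ⟨t + x.2, h⟩⟩, by simp⟩, hb _⟩
      · rw [pow_apply_eq_zero_of_le (hv x.1) (by omega)]
        exact Submodule.zero_mem _
    · rw [Submodule.span_le]
      rintro _ ⟨⟨x, hx⟩, rfl⟩
      refine ⟨(T ^ (x.2 - t : ℕ)) (v x.1), ?_⟩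
      rw [← Module.End.mul_apply, ← pow_add, Nat.add_sub_cancel' hx, ← hb]
  have hli : LinearIndependent K fun x : {x : Σ i, Fin (k i) // t ≤ (x.2 : ℕ)} => b x :=
    b.linearIndependent.comp _ Subtype.val_injective
  rw [hrange, finrank_span_eq_card hli,
    Fintype.card_subtype, Finset.card_filter, Fintype.sum_sigma]
  refine Finset.sum_congr rfl fun i _ => ?_
  rw [Fin.sum_univ_eq_sum_range (fun a => if t ≤ a then 1 else 0), ← Finset.card_filter,
    show (Finset.range (k i)).filter (t ≤ ·) = Finset.Ico t (k i) by ext; simp [and_comm],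
    Nat.card_Ico]

/-- Each truncated difference is the indicator of t < c, respectively of q - 1 - t < d; both hold
exactly for q - d ≤ t < c. -/
theorem sum_range_mul_indicator {c d q : ℕ} (hc : c ≤ q) (hd : d ≤ q) :
    ∑ t ∈ Finset.range q, ((c - t) - (c - (t + 1))) * ((d - (q - 1 - t)) - (d - (q - 1 - t + 1))) =
      c + d - q := by
  rw [Finset.sum_congr rfl (g := fun t => if t ∈ Finset.Ico (q - d) c then 1 else 0),
    ← Finset.card_filter, Finset.filter_mem_eq_inter, Finset.inter_eq_right.mpr, Nat.card_Ico]
  · omega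
  · intro t ht
    simp only [Finset.mem_Ico, Finset.mem_range] at *
    omega
  · intro t ht
    simp only [Finset.mem_Ico, Finset.mem_range] at *
    split_ifs with h
    · rw [show c - t - (c - (t + 1)) = 1 by omega,
        show d - (q - 1 - t) - (d - (q - 1 - t + 1)) = 1 by omega]
    · rcases not_and_or.mp h with h | h
      · rw [show d - (q - 1 - t) - (d - (q - 1 - t + 1)) = 0 by omega, mul_zero]
      · rw [show c - t - (c - (t + 1)) = 0 by omega, zero_mul]

/-- The multiplicity count of `T^(t)`-blocks: the number of Jordan blocks of size larger than `t`. -/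
noncomputable def jordanCount (T : Module.End K W) (t : ℕ) : ℕ :=
  Module.finrank K (LinearMap.range (T ^ t)) - Module.finrank K (LinearMap.range (T ^ (t + 1)))

/-- Blocks of sizes k i and k j contribute the chains of total degree n + q - 1 with n < k i + k j -
q: longer chains vanish, and these are independent. The count k i + k j - q is then spread over t by
`sum_range_mul_indicator`. -/
theorem finrank_range_alternatingTensor [FiniteDimensional K W] {T : Module.End K W} {q : ℕ}
    (hq : 0 < q) (hT : T ^ q = 0) :
    Module.finrank K (LinearMap.range (alternatingTensor T q)) =
      ∑ t ∈ Finset.range q, jordanCount T t * jordanCount T (q - 1 - t) := by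
  classical
  obtain ⟨m, k, v, b, hv, hb⟩ := exists_basis_jordan_chains T q hT
  have hkq : ∀ i, k i ≤ q := by
    intro i
    by_contra! h
    have h1 := hb ⟨i, ⟨q, h⟩⟩
    rw [hT] at h1
    exact b.ne_zero _ h1
  have hcount : ∀ t, jordanCount T t = ∑ i, ((k i - t) - (k i - (t + 1))) := by
    intro t
    rw [jordanCount, finrank_range_pow_eq_card b hv hb, finrank_range_pow_eq_card b hv hb,
      ← Finset.sum_tsub_distrib]
    intro i _
    omega
  simp_rw [hcount, Finset.sum_mul_sum]
  rw [Finset.sum_comm]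
  simp_rw [Finset.sum_comm (s := Finset.range q), sum_range_mul_indicator (hkq _) (hkq _)]
  let w : (Σ x : Fin m × Fin m, Fin (k x.1 + k x.2 - q)) → W ⊗[K] W :=
    fun x => alternatingChain T (v x.1.1) (v x.1.2) (x.2 + q - 1)
  have hrange : LinearMap.range (alternatingTensor T q) = Submodule.span K (Set.range w) := by
    apply le_antisymm
    · rw [LinearMap.range_eq_map, ← (b.tensorProduct b).span_eq, Submodule.map_span,
        Submodule.span_le]
      rintro _ ⟨_, ⟨x, rfl⟩, rfl⟩
      rw [Module.Basis.tensorProduct_apply, hb, hb, alternatingTensor_tmul hT]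
      apply Submodule.smul_mem
      by_cases h : (x.1.2 : ℕ) + x.2.2 < k x.1.1 + k x.2.1 - q
      · exact Submodule.subset_span ⟨⟨⟨x.1.1, x.2.1⟩, ⟨x.1.2 + x.2.2, h⟩⟩, rfl⟩
      · rw [alternatingChain, Finset.sum_eq_zero]
        · exact Submodule.zero_mem _
        intro c _
        by_cases hc : k x.1.1 ≤ c
        · rw [pow_apply_eq_zero_of_le (hv _) hc]
          simp
        · rw [pow_apply_eq_zero_of_le (hv x.2.1)]
          · simp
          · omega
    · rw [Submodule.span_le]
      rintro _ ⟨⟨⟨i, j⟩, n⟩, rfl⟩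
      have hn := n.2
      have hi := hkq i
      have hj := hkq j
      refine ⟨(-1 : K) ^ (n : ℕ) • (T ^ (n : ℕ)) (v i) ⊗ₜ (T ^ 0) (v j), ?_⟩
      rw [map_smul, alternatingTensor_tmul hT, smul_smul, ← pow_add, ← two_mul, pow_mul]
      simp [w]
  have hli : LinearIndependent K w := by
    have hrepr : ∀ (i' : Fin m) (c : ℕ) (x : Σ i, Fin (k i)), b.repr ((T ^ c) (v i')) x =
        if i' = x.1 ∧ c = x.2 then 1 else 0 := by
      intro i' c ⟨i, a⟩
      by_cases h : c < k i'
      · have := hb ⟨i', ⟨c, h⟩⟩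
        simp only at this
        rw [← this, b.repr_self, Finsupp.single_apply]
        refine if_congr ?_ rfl rfl
        constructor
        · intro h'
          cases h'
          exact ⟨rfl, rfl⟩
        · rintro ⟨h1, h2⟩
          simp only at h1 h2
          subst h1 h2
          rfl
      · rw [pow_apply_eq_zero_of_le (hv _) (not_lt.mp h), map_zero, if_neg]
        · rfl
        · rintro ⟨rfl, rfl⟩
          exact h a.2
    have hlt : ∀ x : (Σ x : Fin m × Fin m, Fin (k x.1 + k x.2 - q)),
        k x.1.1 - 1 < k x.1.1 ∧ (x.2 : ℕ) + q - k x.1.1 < k x.1.2 := by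
      intro x
      have := x.2.2
      have := hkq x.1.1
      have := hkq x.1.2
      omega
    -- The functional reads the coordinate in which the first factor is the last vector of its
    -- Jordan chain, and removes the sign; exactly one chain has a nonzero entry there.
    let f : (Σ x : Fin m × Fin m, Fin (k x.1 + k x.2 - q)) → Module.Dual K (W ⊗[K] W) :=
      fun x => (-1 : K) ^ (k x.1.1 - 1) • (b.tensorProduct b).coord
        (⟨x.1.1, ⟨k x.1.1 - 1, (hlt x).1⟩⟩, ⟨x.1.2, ⟨x.2 + q - k x.1.1, (hlt x).2⟩⟩)
    have hf : ∀ x y, f x (w y) = if x = y then 1 else 0 := by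
      intro x y
      have hx := x.2.2
      have hx1 := hkq x.1.1
      have hx2 := hkq x.1.2
      simp only [f, w, alternatingChain, LinearMap.smul_apply, Module.Basis.coord_apply, map_sum,
        map_smul,
        Module.Basis.tensorProduct_repr_tmul_apply, hrepr]
      rw [Finset.sum_eq_single (k x.1.1 - 1)]
      · by_cases h : x = y
        · subst h
          rw [if_pos ⟨rfl, by omega⟩, if_pos ⟨rfl, rfl⟩, if_pos rfl]
          simp only [smul_eq_mul, mul_one]
          rw [← pow_add, ← two_mul, pow_mul]
          simp
        · rw [if_neg h]
          by_cases h1 : y.1 = x.1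
          · rw [if_neg (c := y.1.2 = x.1.2 ∧ _)]
            · simp
            · rintro ⟨-, h2⟩
              apply h
              obtain ⟨x1, x2⟩ := x
              obtain ⟨y1, y2⟩ := y
              simp only at h1
              subst h1
              simp only at h2
              congr 1
              ext
              simp only at hx hx1 hx2
              omega
          · by_cases h2 : y.1.1 = x.1.1
            · rw [if_neg (c := y.1.2 = x.1.2 ∧ _)]
              · simp
              · exact fun h3 => h1 (Prod.ext h2 h3.1)
            · rw [if_neg (c := y.1.1 = x.1.1 ∧ _)]
              · simp
              · exact fun h3 => h2 h3.1
      · intro c _ hc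
        rw [if_neg (c := y.1.1 = x.1.1 ∧ _)]
        · simp
        · exact fun h3 => hc h3.2
      · intro hc
        rw [if_neg (c := y.1.2 = x.1.2 ∧ _)]
        · simp
        · rintro ⟨-, h2⟩
          simp only [Finset.mem_range] at hc h2
          omega
    refine LinearIndependent.of_pairwise_dual_eq_zero_one w f ?_ ?_
    · intro x y hxy
      rw [hf, if_neg hxy]
    · intro x
      rw [hf, if_pos rfl]
  rw [hrange, finrank_span_eq_card hli, Fintype.card_sigma, Fintype.sum_prod_type]
  simp

end KroneckerRank

/-! ### Colengths and colon ideals. -/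

section Colength

variable (K : Type*) {S : Type*} [Field K] [CommRing S] [Algebra K S]

/-- The length of `S ⧸ I` as a `K`-module. -/
noncomputable def colength (I : Ideal S) : ℕ∞ := Module.length K (S ⧸ I)

/-- Additivity of length on 0 → S/(J : a) → S/J → S/(a, J) → 0, the first map being multiplication
by a. -/
theorem colength_eq_add_of_colon {J J' : Ideal S} {a : S} (h : ∀ s, a * s ∈ J ↔ s ∈ J') :
    colength K J = colength K J' + colength K (Ideal.span {a} ⊔ J) := by
  have hle : J' ≤ Submodule.comap (LinearMap.lsmul S S a) J := fun s hs => (h s).mpr hs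
  obtain ⟨f, hf⟩ : ∃ f : (S ⧸ J') →ₗ[S] (S ⧸ J),
      ∀ s, f (Ideal.Quotient.mk J' s) = Ideal.Quotient.mk J (a * s) :=
    ⟨Submodule.mapQ J' J (LinearMap.lsmul S S a) hle, fun s => rfl⟩
  obtain ⟨g, hg, hgs⟩ : ∃ g : (S ⧸ J) →ₗ[S] (S ⧸ (Ideal.span {a} ⊔ J)),
      (∀ s, g (Ideal.Quotient.mk J s) = Ideal.Quotient.mk (Ideal.span {a} ⊔ J) s) ∧
      Function.Surjective g :=
    ⟨Submodule.factor le_sup_right, fun s => rfl, Submodule.factor_surjective _⟩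
  have hinj : Function.Injective f := by
    rw [injective_iff_map_eq_zero]
    intro x hx
    obtain ⟨s, rfl⟩ := Ideal.Quotient.mk_surjective x
    rw [hf, Ideal.Quotient.eq_zero_iff_mem] at hx
    exact Ideal.Quotient.eq_zero_iff_mem.mpr ((h s).mp hx)
  have hexact : ∀ s, g (Ideal.Quotient.mk J s) = 0 ↔ Ideal.Quotient.mk J s ∈ Set.range f := by
    intro s
    have h0 : g (Ideal.Quotient.mk J s) = 0 ↔ s ∈ Ideal.span {a} ⊔ J := by
      rw [hg]
      exact Ideal.Quotient.eq_zero_iff_mem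
    rw [h0, Ideal.mem_span_singleton_sup]
    constructor
    · rintro ⟨t, j, hj, rfl⟩
      refine ⟨Ideal.Quotient.mk J' t, ?_⟩
      rw [hf, Ideal.Quotient.eq]
      have : a * t - (t * a + j) = - j := by ring
      rw [this]
      exact J.neg_mem hj
    · rintro ⟨y, hy⟩
      obtain ⟨t, rfl⟩ := Ideal.Quotient.mk_surjective y
      rw [hf, Ideal.Quotient.eq] at hy
      exact ⟨t, s - a * t, by rw [← neg_sub]; exact J.neg_mem hy, by ring⟩
  refine Module.length_eq_add_of_exact (f.restrictScalars K) (g.restrictScalars K) hinj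
    hgs fun x => ?_
  obtain ⟨s, rfl⟩ := Ideal.Quotient.mk_surjective x
  exact hexact s

theorem colength_span_mul_sup {I G : Ideal S} {a : S} (ha : ∀ s, a * s ∈ G → s ∈ G) :
    colength K (Ideal.span {a} * I ⊔ G) =
      colength K (I ⊔ G) + colength K (Ideal.span {a} ⊔ G) := by
  rw [colength_eq_add_of_colon K (J := Ideal.span {a} * I ⊔ G) (J' := I ⊔ G) (a := a),
    ← sup_assoc, sup_of_le_left (Ideal.mul_le_left : Ideal.span {a} * I ≤ Ideal.span {a})]
  intro s
  constructor
  · intro h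
    obtain ⟨y, hy, z, hz, hyz⟩ := Submodule.mem_sup.mp h
    obtain ⟨i, hi, rfl⟩ := Ideal.mem_span_singleton_mul.mp hy
    refine Submodule.mem_sup.mpr ⟨i, hi, s - i, ha _ ?_, by ring⟩
    rw [mul_sub, ← hyz]
    simpa using hz
  · intro h
    obtain ⟨y, hy, z, hz, rfl⟩ := Submodule.mem_sup.mp h
    rw [mul_add]
    exact Submodule.add_mem_sup (Ideal.mul_mem_mul (Ideal.mem_span_singleton_self a) hy)
      (G.mul_mem_left _ hz)

theorem colength_span_mul_singleton_sup {G : Ideal S} {a : S} (b : S)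
    (ha : ∀ s, a * s ∈ G → s ∈ G) :
    colength K (Ideal.span {a * b} ⊔ G) =
      colength K (Ideal.span {b} ⊔ G) + colength K (Ideal.span {a} ⊔ G) := by
  rw [← colength_span_mul_sup K ha, Ideal.span_singleton_mul_span_singleton]

theorem pow_mul_mem_imp {G : Ideal S} {a : S} (ha : ∀ s, a * s ∈ G → s ∈ G) (n : ℕ) :
    ∀ s, a ^ n * s ∈ G → s ∈ G := by
  induction n with
  | zero => simp
  | succ n ih =>
    intro s hs
    rw [pow_succ, mul_assoc] at hs
    exact ha _ (ih _ hs)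

theorem colength_span_pow_sup {G : Ideal S} {a : S} (ha : ∀ s, a * s ∈ G → s ∈ G) (n : ℕ) :
    colength K (Ideal.span {a ^ n} ⊔ G) = n * colength K (Ideal.span {a} ⊔ G) := by
  induction n with
  | zero =>
    simp only [pow_zero, Ideal.span_singleton_one, top_sup_eq, Nat.cast_zero, zero_mul]
    exact Module.length_eq_zero
  | succ n ih =>
    rw [pow_succ', colength_span_mul_singleton_sup K _ ha, ih]
    push_cast
    ring

/-- Multiplication by `g` on `S ⧸ I`, as a `K`-linear map. -/
noncomputable def mulQuotient (I : Ideal S) (g : S) : Module.End K (S ⧸ I) :=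
  LinearMap.mulLeft K (Ideal.Quotient.mk I g)

theorem mulQuotient_pow (I : Ideal S) (g : S) (n : ℕ) :
    mulQuotient K I g ^ n = mulQuotient K I (g ^ n) := by
  rw [mulQuotient, LinearMap.pow_mulLeft, mulQuotient, map_pow]

/-- Multiplication by g^n on S/I factors through an injection of S/(I : g^n), so ranks become
colengths of colon ideals. -/
theorem finrank_range_mulQuotient_pow {I J : Ideal S} [FiniteDimensional K (S ⧸ I)] {g : S} {n : ℕ}
    (h : ∀ s, g ^ n * s ∈ I ↔ s ∈ J) :
    (Module.finrank K (LinearMap.range (mulQuotient K I g ^ n)) : ℕ∞) = colength K J := by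
  have hle : J ≤ Submodule.comap (LinearMap.lsmul S S (g ^ n)) I := fun s hs => (h s).mpr hs
  let f : (S ⧸ J) →ₗ[S] (S ⧸ I) := Submodule.mapQ J I (LinearMap.lsmul S S (g ^ n)) hle
  have hf : ∀ s, f (Ideal.Quotient.mk J s) = Ideal.Quotient.mk I (g ^ n * s) := fun s => rfl
  have hinj : Function.Injective (f.restrictScalars K) := by
    rw [LinearMap.coe_restrictScalars, injective_iff_map_eq_zero]
    intro x hx
    obtain ⟨s, rfl⟩ := Ideal.Quotient.mk_surjective x
    rw [hf, Ideal.Quotient.eq_zero_iff_mem] at hx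
    exact Ideal.Quotient.eq_zero_iff_mem.mpr ((h s).mp hx)
  have hrange : LinearMap.range (mulQuotient K I g ^ n) = LinearMap.range (f.restrictScalars K) := by
    rw [mulQuotient_pow]
    ext y
    constructor
    · rintro ⟨x, rfl⟩
      obtain ⟨s, rfl⟩ := Ideal.Quotient.mk_surjective x
      exact ⟨Ideal.Quotient.mk J s, rfl⟩
    · rintro ⟨x, rfl⟩
      obtain ⟨s, rfl⟩ := Ideal.Quotient.mk_surjective x
      exact ⟨Ideal.Quotient.mk I s, rfl⟩
  rw [hrange, ← Module.length_eq_finrank]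
  exact (LinearEquiv.ofInjective _ hinj).length_eq.symm

end Colength

/-! ### The pairs of forms generating the colon ideals. -/

section FermatPair

variable {S : Type*} [CommRing S]

/-- One step of the recursion for the generators of `(x^p, y^p) : (x^3 + y^3)^t`, `t` even. -/
def fermatPairStep (x y : S) (d : ℕ) (A B : S) : S × S :=
  ((d + 1) * x * (x ^ 2 * A - y ^ 2 * B) - (d + 2) * y ^ 2 * (y * A + x * B),
    (d + 1) * y * (x ^ 2 * A - y ^ 2 * B) + (d + 2) * x ^ 2 * (y * A + x * B))

/-- A sequence of pairs of forms in `x, y` of degree `d₀ + 3 k`, where `d₀` is `1` or `2`. -/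
def fermatPair (x y : S) (d₀ : ℕ) : ℕ → S × S
  | 0 => if d₀ = 1 then (x, y) else (y ^ 2, -x ^ 2)
  | k + 1 => fermatPairStep x y (d₀ + 3 * k) (fermatPair x y d₀ k).1 (fermatPair x y d₀ k).2

theorem map_fermatPair {S' : Type*} [CommRing S'] (φ : S →+* S') (x y : S) (d₀ k : ℕ) :
    φ (fermatPair x y d₀ k).1 = (fermatPair (φ x) (φ y) d₀ k).1 ∧
      φ (fermatPair x y d₀ k).2 = (fermatPair (φ x) (φ y) d₀ k).2 := by
  induction k with
  | zero =>
    simp only [fermatPair]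
    split_ifs <;> simp
  | succ k ih =>
    simp only [fermatPair, fermatPairStep, ← ih.1, ← ih.2]
    simp [map_ofNat φ 2, map_ofNat φ 3]

/-- Modulo x^3 + y^3 the pair is proportional to (x, y). In the recursion the terms in x^2 A - y^2 B
cancel, and the rest has the factor x^3 + y^3. -/
theorem cube_add_cube_dvd_fermatPair (x y : S) (d₀ k : ℕ) :
    x ^ 3 + y ^ 3 ∣ x * (fermatPair x y d₀ k).2 - y * (fermatPair x y d₀ k).1 := by
  cases k with
  | zero =>
    simp only [fermatPair]
    split_ifs
    · simp [mul_comm]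
    · exact ⟨-1, by ring⟩
  | succ k =>
    refine ⟨(d₀ + 3 * k + 2) * (y * (fermatPair x y d₀ k).1 + x * (fermatPair x y d₀ k).2), ?_⟩
    simp only [fermatPair, fermatPairStep]
    push_cast
    ring

/-- By x B ≡ y A and y^3 ≡ -x^3, one step from degree d multiplies the first form by 2(2d+3)x^3. If
these constants are units, the form is a nonzerodivisor modulo x^3 + y^3 whenever x and y are. -/
theorem fermatPair_fst_congr (x y : S) (d₀ k : ℕ) :
    x ^ 3 + y ^ 3 ∣ (fermatPair x y d₀ k).1 -
      (∏ j ∈ Finset.range k, (2 * (2 * ((d₀ + 3 * j : ℕ) : S) + 3))) *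
        (x ^ (3 * k) * (fermatPair x y d₀ 0).1) := by
  induction k with
  | zero => simp
  | succ k ih =>
    obtain ⟨e, he⟩ := cube_add_cube_dvd_fermatPair x y d₀ k
    obtain ⟨f, hf⟩ := ih
    rw [Finset.prod_range_succ]
    generalize (∏ j ∈ Finset.range k, (2 * (2 * ((d₀ + 3 * j : ℕ) : S) + 3))) = c at *
    simp only [fermatPair, fermatPairStep] at he hf ⊢
    generalize (fermatPair x y d₀ k).1 = A at *
    generalize (fermatPair x y d₀ k).2 = B at *
    generalize (if d₀ = 1 then (x, y) else (y ^ 2, -x ^ 2)).1 = A₀ at *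
    generalize ((d₀ + 3 * k : ℕ) : S) = d at *
    refine ⟨2 * (2 * d + 3) * x ^ 3 * f - (3 * d + 5) * A - (2 * d + 3) * y ^ 2 * e, ?_⟩
    linear_combination 2 * (2 * d + 3) * x ^ 3 * hf - (2 * d + 3) * y ^ 2 * he

theorem dvd_of_dvd_fermatPair_mul {x y : S} {d₀ k : ℕ}
    (hx : ∀ s, x ^ 3 + y ^ 3 ∣ x * s → x ^ 3 + y ^ 3 ∣ s)
    (hy : ∀ s, x ^ 3 + y ^ 3 ∣ y * s → x ^ 3 + y ^ 3 ∣ s)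
    (hc : IsUnit (∏ j ∈ Finset.range k, (2 * (2 * ((d₀ + 3 * j : ℕ) : S) + 3)))) (s : S)
    (hs : x ^ 3 + y ^ 3 ∣ (fermatPair x y d₀ k).1 * s) : x ^ 3 + y ^ 3 ∣ s := by
  have hxn : ∀ (n : ℕ) (s : S), x ^ 3 + y ^ 3 ∣ x ^ n * s → x ^ 3 + y ^ 3 ∣ s := by
    intro n
    induction n with
    | zero => simp
    | succ n ih =>
      intro s hs
      rw [pow_succ x n, mul_assoc] at hs
      exact hx _ (ih _ hs)
  have h1 : x ^ 3 + y ^ 3 ∣ (fermatPair x y d₀ 0).1 * s := by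
    apply hxn (3 * k)
    rw [← hc.dvd_mul_left]
    have := dvd_sub hs ((fermatPair_fst_congr x y d₀ k).mul_right s)
    convert this using 1
    ring
  simp only [fermatPair] at h1
  split_ifs at h1
  · exact hx _ h1
  · rw [pow_two, mul_assoc] at h1
    exact hy _ (hy _ h1)

/-! ### Colon ideals -/

variable {X Y A B : S}

/-- A combination with coefficients a, b of the two generators equals A(aY + bX^2) + B(aX - bY^2).
Modulo X^3 + Y^3, X times it is 2AX(aY + bX^2), so cancellation makes both brackets divisible by the
cubic. -/
theorem mul_mem_span_pair_iff_even [IsDomain S] (hG : X ^ 3 + Y ^ 3 ≠ 0) (h2 : IsUnit (2 : S))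
    (hX : ∀ s, X ^ 3 + Y ^ 3 ∣ X * s → X ^ 3 + Y ^ 3 ∣ s)
    (hY : ∀ s, X ^ 3 + Y ^ 3 ∣ Y * s → X ^ 3 + Y ^ 3 ∣ s)
    (hA : ∀ s, X ^ 3 + Y ^ 3 ∣ A * s → X ^ 3 + Y ^ 3 ∣ s)
    (hAB : X ^ 3 + Y ^ 3 ∣ X * B - Y * A) (h : S) :
    (X ^ 3 + Y ^ 3) * h ∈ Ideal.span {Y * A + X * B, X ^ 2 * A - Y ^ 2 * B} ↔
      h ∈ Ideal.span {A, B} := by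
  obtain ⟨e, he⟩ := hAB
  rw [Ideal.mem_span_pair, Ideal.mem_span_pair]
  constructor
  · rintro ⟨a, b, hab⟩
    have h1 : X ^ 3 + Y ^ 3 ∣ a * Y + b * X ^ 2 := by
      apply hX
      rw [← h2.dvd_mul_left]
      apply hA
      exact ⟨X * h - (a * X - b * Y ^ 2) * e + b * A, by
        linear_combination X * hab - (a * X - b * Y ^ 2) * he⟩
    have h3 : X ^ 3 + Y ^ 3 ∣ a * X - b * Y ^ 2 := by
      apply hY
      obtain ⟨u, hu⟩ := h1
      exact ⟨X * u - b, by linear_combination X * hu⟩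
    obtain ⟨u, hu⟩ := h1
    obtain ⟨v, hv⟩ := h3
    exact ⟨u, v, mul_left_cancel₀ hG (by linear_combination hab - A * hu - B * hv)⟩
  · rintro ⟨a, b, rfl⟩
    exact ⟨a * Y ^ 2 + b * X ^ 2, a * X - b * Y, by ring⟩

/-- With C = YA + XB and D = X^2 A - Y^2 B, a combination of the step forms is (d+2)C(bX^2 - aY^2) +
(d+1)D(aX + bY). Both products are multiples of 2YA(bX^2 - aY^2) modulo the cubic, with total factor
(d+1) + (d+2) = 2d + 3. -/
theorem mul_mem_span_pair_iff_odd [IsDomain S] (hG : X ^ 3 + Y ^ 3 ≠ 0) (h2 : IsUnit (2 : S))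
    (hY : ∀ s, X ^ 3 + Y ^ 3 ∣ Y * s → X ^ 3 + Y ^ 3 ∣ s)
    (hA : ∀ s, X ^ 3 + Y ^ 3 ∣ A * s → X ^ 3 + Y ^ 3 ∣ s)
    (hAB : X ^ 3 + Y ^ 3 ∣ X * B - Y * A) {d : ℕ} (h3 : IsUnit ((d : S) + 1))
    (h4 : IsUnit ((d : S) + 2)) (h5 : IsUnit (2 * (d : S) + 3)) (h : S) :
    (X ^ 3 + Y ^ 3) * h ∈ Ideal.span {(fermatPairStep X Y d A B).1, (fermatPairStep X Y d A B).2} ↔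
      h ∈ Ideal.span {Y * A + X * B, X ^ 2 * A - Y ^ 2 * B} := by
  obtain ⟨e, he⟩ := hAB
  rw [Ideal.mem_span_pair, Ideal.mem_span_pair, fermatPairStep]
  constructor
  · rintro ⟨a, b, hab⟩
    simp only at hab
    have h6 : X ^ 3 + Y ^ 3 ∣ b * X ^ 2 - a * Y ^ 2 := by
      apply hA
      apply hY
      rw [← h2.dvd_mul_left, ← h5.dvd_mul_left]
      exact ⟨h - (d + 1) * (a * A - b * B) - (2 * d + 3) * (b * X ^ 2 - a * Y ^ 2) * e, by
        linear_combination hab - (2 * d + 3) * (b * X ^ 2 - a * Y ^ 2) * he⟩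
    have h7 : X ^ 3 + Y ^ 3 ∣ a * X + b * Y := by
      apply hY
      apply hY
      obtain ⟨u, hu⟩ := h6
      exact ⟨b - X * u, by linear_combination - X * hu⟩
    obtain ⟨u, hu⟩ := h6
    obtain ⟨v, hv⟩ := h7
    exact ⟨(d + 2) * u, (d + 1) * v, mul_left_cancel₀ hG (by
      linear_combination hab - (d + 2) * (Y * A + X * B) * hu -
        (d + 1) * (X ^ 2 * A - Y ^ 2 * B) * hv)⟩
  · obtain ⟨u, hu⟩ := h3.exists_right_inv
    obtain ⟨v, hv⟩ := h4.exists_right_inv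
    rintro ⟨a, b, rfl⟩
    refine ⟨-v * a * Y + u * b * X ^ 2, v * a * X + u * b * Y ^ 2, ?_⟩
    linear_combination (X ^ 3 + Y ^ 3) * a * (Y * A + X * B) * hv +
      (X ^ 3 + Y ^ 3) * b * (X ^ 2 * A - Y ^ 2 * B) * hu

end FermatPair

/-! ### The differential system satisfied by the pairs. -/

section Derivative

open MvPolynomial

variable {R : Type*} [CommRing R]

theorem isHomogeneous_fermatPair {d₀ : ℕ} (hd₀ : d₀ = 1 ∨ d₀ = 2) (k : ℕ) :
    (fermatPair (X 0 : MvPolynomial (Fin 2) R) (X 1) d₀ k).1.IsHomogeneous (d₀ + 3 * k) ∧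
    (fermatPair (X 0 : MvPolynomial (Fin 2) R) (X 1) d₀ k).2.IsHomogeneous (d₀ + 3 * k) := by
  have hX : ∀ (i : Fin 2) (n : ℕ), (X i ^ n : MvPolynomial (Fin 2) R).IsHomogeneous n :=
    fun i n => isHomogeneous_X_pow i n
  induction k with
  | zero =>
    rcases hd₀ with rfl | rfl
    · simp [fermatPair, isHomogeneous_X]
    · exact ⟨hX 1 2, (hX 0 2).neg⟩
  | succ k ih =>
    obtain ⟨hA, hB⟩ := ih
    have hc : ∀ n : ℕ, (n : MvPolynomial (Fin 2) R).IsHomogeneous 0 := fun n => by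
      rw [← map_natCast (C : R →+* MvPolynomial (Fin 2) R)]
      exact isHomogeneous_C _ _
    have h1 : ((d₀ + 3 * k : ℕ) + 1 : MvPolynomial (Fin 2) R).IsHomogeneous 0 := by
      exact_mod_cast hc _
    have h2 : ((d₀ + 3 * k : ℕ) + 2 : MvPolynomial (Fin 2) R).IsHomogeneous 0 := by
      exact_mod_cast hc _
    have hD := ((hX 0 2).mul hA).sub ((hX 1 2).mul hB)
    have hC := ((isHomogeneous_X R (1 : Fin 2)).mul hA).add ((isHomogeneous_X R (0 : Fin 2)).mul hB)
    rw [fermatPair, fermatPairStep]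
    constructor
    · have e1 := (h1.mul (isHomogeneous_X R (0 : Fin 2))).mul hD
      have e2 := (h2.mul (hX 1 2)).mul hC
      rw [show 0 + 1 + (2 + (d₀ + 3 * k)) = d₀ + 3 * (k + 1) by ring] at e1
      rw [show 0 + 2 + (1 + (d₀ + 3 * k)) = d₀ + 3 * (k + 1) by ring] at e2
      exact e1.sub e2
    · have e1 := (h1.mul (isHomogeneous_X R (1 : Fin 2))).mul hD
      have e2 := (h2.mul (hX 0 2)).mul hC
      rw [show 0 + 1 + (2 + (d₀ + 3 * k)) = d₀ + 3 * (k + 1) by ring] at e1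
      rw [show 0 + 2 + (1 + (d₀ + 3 * k)) = d₀ + 3 * (k + 1) by ring] at e2
      exact e1.add e2

/-- The coefficients d + 1 and d + 2 of `fermatPairStep` preserve this system. The factor d on the
right is the degree, so all partial derivatives vanish once the degree is p. -/
theorem pderiv_fermatPair {d₀ : ℕ} (hd₀ : d₀ = 1 ∨ d₀ = 2) (k : ℕ) :
    let x : MvPolynomial (Fin 2) R := X 0
    let y : MvPolynomial (Fin 2) R := X 1
    let A := (fermatPair x y d₀ k).1
    let B := (fermatPair x y d₀ k).2
    let d : MvPolynomial (Fin 2) R := ((d₀ + 3 * k : ℕ) : MvPolynomial (Fin 2) R)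
    (x ^ 3 + y ^ 3) * pderiv 0 A = d * (x ^ 2 * A + y ^ 2 * B) ∧
    (x ^ 3 + y ^ 3) * pderiv 1 A = d * (y ^ 2 * A - x * y * B) ∧
    (x ^ 3 + y ^ 3) * pderiv 0 B = d * (x ^ 2 * B - x * y * A) ∧
    (x ^ 3 + y ^ 3) * pderiv 1 B = d * (y ^ 2 * B + x ^ 2 * A) := by
  intro x y
  have h00 : pderiv 0 x = 1 := pderiv_X_self _
  have h11 : pderiv 1 y = 1 := pderiv_X_self _
  have h01 : pderiv 0 y = 0 := pderiv_X_of_ne (by simp)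
  have h10 : pderiv 1 x = 0 := pderiv_X_of_ne (by simp)
  induction k with
  | zero =>
    rcases hd₀ with rfl | rfl <;>
      simp [fermatPair, h00, h11, h01, h10] <;> ring_nf <;> simp
  | succ k ih =>
    intro A B d
    obtain ⟨h1, h2, h3, h4⟩ := ih
    have hd : ∀ i, pderiv i ((d₀ + 3 * k : ℕ) : MvPolynomial (Fin 2) R) = 0 :=
      fun i => Derivation.map_natCast _ _
    have hd1 : d = ((d₀ + 3 * k : ℕ) : MvPolynomial (Fin 2) R) + 3 := by
      simp only [d]
      push_cast
      ring
    have hn : ∀ (i : Fin 2) (n : ℕ) [n.AtLeastTwo],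
        pderiv i (ofNat(n) : MvPolynomial (Fin 2) R) = 0 :=
      fun i n _ => Derivation.map_natCast _ _
    rw [hd1]
    simp only [A, B, fermatPair, fermatPairStep]
    generalize ((d₀ + 3 * k : ℕ) : MvPolynomial (Fin 2) R) = d' at *
    generalize (fermatPair x y d₀ k).1 = A' at *
    generalize (fermatPair x y d₀ k).2 = B' at *
    simp only [map_add, map_sub, Derivation.leibniz, Derivation.leibniz_pow, hd, hn, h00, h01, h10,
      h11, smul_eq_mul, Derivation.map_one_eq_zero, nsmul_eq_mul, Nat.add_one_sub_one, pow_one]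
    push_cast
    refine ⟨?_, ?_, ?_, ?_⟩
    · linear_combination ((d' + 1) * x ^ 3 - (d' + 2) * y ^ 3) * h1 - (2 * d' + 3) * x * y ^ 2 * h3
    · linear_combination ((d' + 1) * x ^ 3 - (d' + 2) * y ^ 3) * h2 - (2 * d' + 3) * x * y ^ 2 * h4
    · linear_combination (2 * d' + 3) * x ^ 2 * y * h1 + ((d' + 2) * x ^ 3 - (d' + 1) * y ^ 3) * h3
    · linear_combination (2 * d' + 3) * x ^ 2 * y * h2 + ((d' + 2) * x ^ 3 - (d' + 1) * y ^ 3) * h4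

end Derivative

/-! ### The pair of degree p in characteristic p. -/

section CharP

open MvPolynomial

variable {K : Type*} [Field K]

theorem not_X_dvd_cube_add_cube (i : Fin 2) :
    ¬ (X i : MvPolynomial (Fin 2) K) ∣ X 0 ^ 3 + X 1 ^ 3 := by
  rintro ⟨u, hu⟩
  have := congrArg (MvPolynomial.eval (fun j => if j = i then (0 : K) else 1)) hu
  fin_cases i <;> simp at this

theorem dvd_of_pow_dvd_X_mul (i : Fin 2) (n : ℕ) (s : MvPolynomial (Fin 2) K)
    (h : (X 0 ^ 3 + X 1 ^ 3) ^ n ∣ X i * s) : (X 0 ^ 3 + X 1 ^ 3) ^ n ∣ s := by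
  obtain ⟨u, hu⟩ := h
  have hp : Prime (X i : MvPolynomial (Fin 2) K) := X_prime
  have h1 : X i ∣ u := by
    have h2 : X i ∣ (X 0 ^ 3 + X 1 ^ 3) ^ n * u := ⟨s, hu.symm⟩
    exact (hp.dvd_or_dvd h2).resolve_left
      fun h3 => not_X_dvd_cube_add_cube i (hp.dvd_of_dvd_pow h3)
  obtain ⟨v, rfl⟩ := h1
  exact ⟨v, mul_left_cancel₀ hp.ne_zero (by rw [hu]; ring)⟩

theorem dvd_of_pow_dvd_X_pow_mul (i : Fin 2) (n m : ℕ) (s : MvPolynomial (Fin 2) K)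
    (h : (X 0 ^ 3 + X 1 ^ 3) ^ n ∣ X i ^ m * s) : (X 0 ^ 3 + X 1 ^ 3) ^ n ∣ s := by
  induction m generalizing s with
  | zero => simpa using h
  | succ m ih =>
    rw [pow_succ (X i) m, mul_assoc] at h
    exact dvd_of_pow_dvd_X_mul i n _ (ih _ h)

/-- Vanishing derivatives leave only exponents divisible by p; in total degree p these are (p, 0)
and (0, p). -/
theorem eq_add_of_pderiv_eq_zero (p : ℕ) [Fact p.Prime] [CharP K p] {F : MvPolynomial (Fin 2) K}
    (hF : F.IsHomogeneous p) (h : ∀ i, pderiv i F = 0) :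
    ∃ a b : K, F = C a * X 0 ^ p + C b * X 1 ^ p := by
  classical
  have hp : p.Prime := Fact.out
  refine ⟨coeff (Finsupp.single 0 p) F, coeff (Finsupp.single 1 p) F, ?_⟩
  have h01 : (Finsupp.single 0 p : Fin 2 →₀ ℕ) ≠ Finsupp.single 1 p := by
    intro h
    have := DFunLike.congr_fun h 0
    simp at this
    exact hp.ne_zero this
  ext n
  rw [coeff_add, coeff_C_mul, coeff_C_mul, coeff_X_pow, coeff_X_pow]
  by_cases hn0 : Finsupp.single 0 p = n
  · subst hn0
    simp [h01.symm]
  by_cases hn1 : Finsupp.single 1 p = n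
  · subst hn1
    simp [h01]
  rw [if_neg hn0, if_neg hn1, mul_zero, mul_zero, add_zero]
  by_contra hne
  have hdeg : n 0 + n 1 = p := by
    have := hF hne
    rw [Finsupp.weight_apply] at this
    simpa [Finsupp.sum_fintype] using this
  have hdvd : ∀ i, p ∣ n i := by
    intro i
    by_contra hi
    have hi0 : n i ≠ 0 := fun h0 => hi (h0 ▸ dvd_zero p)
    have h1 := coeff_pderiv (i := i) F (n - Finsupp.single i 1)
    rw [h i, tsub_add_cancel_of_le (by simpa [Finsupp.single_le_iff] using Nat.one_le_iff_ne_zero.mpr hi0), coeff_zero] at h1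
    rcases mul_eq_zero.mp h1.symm with h2 | h2
    · exact hne h2
    · apply hi
      rw [← CharP.cast_eq_zero_iff K p]
      rw [← h2]
      simp
      rw [← Nat.cast_add_one, Nat.sub_add_cancel (Nat.one_le_iff_ne_zero.mpr hi0)]
  rcases Nat.eq_zero_or_pos (n 0) with h0 | h0
  · apply hn1
    ext i
    fin_cases i <;> simp <;> omega
  · have h2 := Nat.le_of_dvd h0 (hdvd 0)
    apply hn0
    ext i
    fin_cases i <;> simp <;> omega

theorem eq_zero_of_cube_add_cube_dvd {a b : K}
    (h : (X 0 ^ 3 + X 1 ^ 3 : MvPolynomial (Fin 2) K) ∣ C a * X 0 + C b * X 1) : a = 0 ∧ b = 0 := by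
  obtain ⟨u, hu⟩ := h
  have hl : (C a * X 0 + C b * X 1 : MvPolynomial (Fin 2) K).IsHomogeneous 1 :=
    ((isHomogeneous_C (Fin 2) a).mul (isHomogeneous_X K (0 : Fin 2))).add
      ((isHomogeneous_C (Fin 2) b).mul (isHomogeneous_X K (1 : Fin 2)))
  have hg : (X 0 ^ 3 + X 1 ^ 3 : MvPolynomial (Fin 2) K).IsHomogeneous 3 :=
    (isHomogeneous_X_pow 0 3).add (isHomogeneous_X_pow 1 3)
  have hg0 : (X 0 ^ 3 + X 1 ^ 3 : MvPolynomial (Fin 2) K) ≠ 0 :=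
    fun h => not_X_dvd_cube_add_cube (K := K) 0 (h ▸ dvd_zero _)
  have hzero : (C a * X 0 + C b * X 1 : MvPolynomial (Fin 2) K) = 0 := by
    by_contra hne
    have hu0 : u ≠ 0 := by
      rintro rfl
      exact hne (by rw [hu, mul_zero])
    have h1 := hl.totalDegree hne
    rw [hu, totalDegree_mul_of_isDomain hg0 hu0, hg.totalDegree hg0] at h1
    omega
  constructor
  · simpa using congrArg (MvPolynomial.eval ![1, 0]) hzero
  · simpa using congrArg (MvPolynomial.eval ![0, 1]) hzero

/-- Both forms are combinations of x^p and y^p. They are independent: a relation aA + bB = 0 gives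
x^3 + y^3 ∣ A(ax + by), hence x^3 + y^3 ∣ ax + by, impossible by degree unless a = b = 0. The change
of basis is then invertible. -/
theorem span_fermatPair_eq (p : ℕ) [Fact p.Prime] [CharP K p] {d₀ m : ℕ}
    (hd₀ : d₀ = 1 ∨ d₀ = 2) (hp : p = d₀ + 3 * m)
    (hc : IsUnit (∏ j ∈ Finset.range m,
      (2 * (2 * ((d₀ + 3 * j : ℕ) : MvPolynomial (Fin 2) K) + 3)))) :
    Ideal.span {(fermatPair (X 0 : MvPolynomial (Fin 2) K) (X 1) d₀ m).1,
      (fermatPair (X 0) (X 1) d₀ m).2} = Ideal.span {X 0 ^ p, X 1 ^ p} := by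
  have hG : (X 0 ^ 3 + X 1 ^ 3 : MvPolynomial (Fin 2) K) ≠ 0 :=
    fun h => not_X_dvd_cube_add_cube (K := K) 0 (h ▸ dvd_zero _)
  have hpd := pderiv_fermatPair (R := K) hd₀ m
  have hhom := isHomogeneous_fermatPair (R := K) hd₀ m
  have hdvd := cube_add_cube_dvd_fermatPair (X 0 : MvPolynomial (Fin 2) K) (X 1) d₀ m
  have hA := dvd_of_dvd_fermatPair_mul (k := m) (d₀ := d₀)
    (fun s hs => by simpa using dvd_of_pow_dvd_X_mul (K := K) 0 1 s (by simpa using hs))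
    (fun s hs => by simpa using dvd_of_pow_dvd_X_mul (K := K) 1 1 s (by simpa using hs)) hc
  rw [← hp] at hpd hhom
  have hp0 : (p : MvPolynomial (Fin 2) K) = 0 := CharP.cast_eq_zero _ p
  simp only [hp0, zero_mul, mul_eq_zero, hG, false_or] at hpd
  generalize (fermatPair (X 0 : MvPolynomial (Fin 2) K) (X 1) d₀ m).1 = A at *
  generalize (fermatPair (X 0 : MvPolynomial (Fin 2) K) (X 1) d₀ m).2 = B at *
  have hind : ∀ a b : K, C a * A + C b * B = 0 → a = 0 ∧ b = 0 := by
    intro a b hab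
    apply eq_zero_of_cube_add_cube_dvd
    apply hA
    obtain ⟨e, he⟩ := hdvd
    exact ⟨- C b * e, by linear_combination X 0 * hab - C b * he⟩
  obtain ⟨a₁, a₂, ha⟩ := eq_add_of_pderiv_eq_zero p hhom.1 (by
    intro i; fin_cases i; exacts [hpd.1, hpd.2.1])
  obtain ⟨b₁, b₂, hb⟩ := eq_add_of_pderiv_eq_zero p hhom.2 (by
    intro i; fin_cases i; exacts [hpd.2.2.1, hpd.2.2.2])
  have hdet : a₁ * b₂ - a₂ * b₁ ≠ 0 := by
    intro h0
    have h0' : (C (a₁ * b₂ - a₂ * b₁) : MvPolynomial (Fin 2) K) = 0 := by rw [h0, C_0]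
    simp only [C_sub, C_mul] at h0'
    have h1 := hind b₂ (-a₂) (by rw [ha, hb, C_neg]; linear_combination X 0 ^ p * h0')
    have h2 := hind (-b₁) a₁ (by rw [ha, hb, C_neg]; linear_combination X 1 ^ p * h0')
    have h3 : A = 0 := by rw [ha, h2.2, neg_eq_zero.mp h1.2]; simp
    exact one_ne_zero (hind 1 0 (by rw [h3]; simp)).1
  have hinv : (C (a₁ * b₂ - a₂ * b₁)⁻¹ : MvPolynomial (Fin 2) K) * (C a₁ * C b₂ - C a₂ * C b₁) = 1 := by
    rw [← C_mul, ← C_mul, ← C_sub, ← C_mul, inv_mul_cancel₀ hdet, C_1]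
  generalize (C (a₁ * b₂ - a₂ * b₁)⁻¹ : MvPolynomial (Fin 2) K) = v at hinv
  apply le_antisymm
  · rw [Ideal.span_le]
    rintro z (rfl | rfl)
    · exact Ideal.mem_span_pair.mpr ⟨_, _, ha.symm⟩
    · exact Ideal.mem_span_pair.mpr ⟨_, _, hb.symm⟩
  · rw [Ideal.span_le]
    rintro z (rfl | rfl)
    · exact Ideal.mem_span_pair.mpr ⟨v * C b₂, - v * C a₂, by
        rw [ha, hb]; linear_combination X 0 ^ p * hinv⟩
    · exact Ideal.mem_span_pair.mpr ⟨- v * C b₁, v * C a₁, by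
        rw [ha, hb]; linear_combination X 1 ^ p * hinv⟩

end CharP

/-! ### Colengths of proportional pairs. -/

section Colength

variable (K : Type*) {S : Type*} [Field K] [CommRing S] [Algebra K S]

theorem span_pair_sup_eq_of_sub_mem {G : Ideal S} {a b a' b' : S} (ha : a - a' ∈ G)
    (hb : b - b' ∈ G) : Ideal.span {a, b} ⊔ G = Ideal.span {a', b'} ⊔ G := by
  have key : ∀ {a b a' b' : S}, a - a' ∈ G → b - b' ∈ G →
      Ideal.span {a, b} ⊔ G ≤ Ideal.span {a', b'} ⊔ G := by
    intro a b a' b' ha hb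
    refine sup_le (Ideal.span_le.mpr ?_) le_sup_right
    rintro z (rfl | rfl)
    · exact Submodule.mem_sup.mpr ⟨a', Ideal.subset_span (by simp), _, ha, by ring⟩
    · exact Submodule.mem_sup.mpr ⟨b', Ideal.subset_span (by simp), _, hb, by ring⟩
  refine le_antisymm (key ha hb) (key ?_ ?_)
  · rw [← neg_sub]; exact G.neg_mem ha
  · rw [← neg_sub]; exact G.neg_mem hb

theorem span_singleton_sup_eq_of_sub_mem {G : Ideal S} {a a' : S} (ha : a - a' ∈ G) :
    Ideal.span {a} ⊔ G = Ideal.span {a'} ⊔ G := by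
  simpa using span_pair_sup_eq_of_sub_mem ha ha

/-- The ideals a(b₁, b₂) and c(c₁, c₂) agree modulo G; `colength_span_mul_sup` splits off the
nonzerodivisors a and c on the two sides. -/
theorem colength_add_eq_of_proportional {G : Ideal S} {a c b₁ b₂ c₁ c₂ : S}
    (ha : ∀ s, a * s ∈ G → s ∈ G) (hc : ∀ s, c * s ∈ G → s ∈ G)
    (h₁ : a * b₁ - c * c₁ ∈ G) (h₂ : a * b₂ - c * c₂ ∈ G) :
    colength K (Ideal.span {b₁, b₂} ⊔ G) + colength K (Ideal.span {a} ⊔ G) =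
      colength K (Ideal.span {c₁, c₂} ⊔ G) + colength K (Ideal.span {c} ⊔ G) := by
  have hpair : ∀ a b₁ b₂ : S, Ideal.span {a} * Ideal.span {b₁, b₂} =
      Ideal.span {a * b₁, a * b₂} := by
    intro a b₁ b₂
    rw [Ideal.span_mul_span', Set.singleton_mul, Set.image_pair]
  rw [← colength_span_mul_sup K ha, ← colength_span_mul_sup K hc, hpair, hpair,
    span_pair_sup_eq_of_sub_mem h₁ h₂]

end Colength

/-! ### Basic colengths in K[x, y]. -/

section PlaneCubic

open MvPolynomial

variable (K : Type*) [Field K]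

/-- The binary cubic `x^3 + y^3`. -/
noncomputable abbrev planeCubic : MvPolynomial (Fin 2) K := X 0 ^ 3 + X 1 ^ 3

/-- The ideal `(x^q, y^q)` of `K[x, y]`. -/
noncomputable abbrev planeFrobeniusIdeal (q : ℕ) : Ideal (MvPolynomial (Fin 2) K) :=
  Ideal.span {X 0 ^ q, X 1 ^ q}

variable {K}

theorem colength_X_sup_X :
    colength K (Ideal.span {(X 0 : MvPolynomial (Fin 2) K)} ⊔ Ideal.span {X 1}) = 1 := by
  have hker : Ideal.span {(X 0 : MvPolynomial (Fin 2) K)} ⊔ Ideal.span {X 1} =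
      RingHom.ker (aeval (fun _ => 0) : MvPolynomial (Fin 2) K →ₐ[K] K) := by
    rw [← Ideal.span_union]
    have : ({X 0} ∪ {X 1} : Set (MvPolynomial (Fin 2) K)) = X '' Set.univ := by
      ext z
      simp [Fin.exists_fin_two, eq_comm, or_comm]
    rw [this]
    ext z
    rw [mem_ideal_span_X_image, RingHom.mem_ker]
    have h0 : (aeval (fun _ => 0) : MvPolynomial (Fin 2) K →ₐ[K] K) z = coeff 0 z := by
      rw [← constantCoeff_eq]
      exact aeval_zero' z
    rw [h0]
    constructor
    · intro h
      by_contra hne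
      obtain ⟨i, -, hi⟩ := h 0 (mem_support_iff.mpr hne)
      simp at hi
    · intro h m hm
      by_contra! hcon
      have : m = 0 := by
        ext i
        simpa using hcon i (Set.mem_univ _)
      rw [this, mem_support_iff] at hm
      exact hm h
  rw [hker, colength]
  have e := Ideal.quotientKerAlgEquivOfSurjective
    (f := (aeval (fun _ => 0) : MvPolynomial (Fin 2) K →ₐ[K] K)) (fun a => ⟨C a, by simp⟩)
  refine e.toLinearEquiv.length_eq.trans ?_
  rw [Module.length_eq_finrank]
  simp

theorem not_X_dvd_X {i j : Fin 2} (h : i ≠ j) : ¬ (X i : MvPolynomial (Fin 2) K) ∣ X j := by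
  rw [X_dvd_X]
  simp [h]

theorem mem_span_X_pow_of_mul_mem {i j : Fin 2} (h : i ≠ j) (n : ℕ) (s : MvPolynomial (Fin 2) K)
    (hs : X j * s ∈ Ideal.span {(X i : MvPolynomial (Fin 2) K) ^ n}) :
    s ∈ Ideal.span {(X i : MvPolynomial (Fin 2) K) ^ n} := by
  rw [Ideal.mem_span_singleton] at *
  exact (X_prime (i := i)).pow_dvd_of_dvd_mul_left n (not_X_dvd_X h) hs

theorem mem_span_X_pow_of_planeCubic_mul_mem (i : Fin 2) (n : ℕ) (s : MvPolynomial (Fin 2) K)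
    (hs : planeCubic K * s ∈ Ideal.span {(X i : MvPolynomial (Fin 2) K) ^ n}) :
    s ∈ Ideal.span {(X i : MvPolynomial (Fin 2) K) ^ n} := by
  rw [Ideal.mem_span_singleton] at *
  exact (X_prime (i := i)).pow_dvd_of_dvd_mul_left n (not_X_dvd_cube_add_cube i) hs

theorem mem_span_planeCubic_pow_of_mul_mem (i : Fin 2) (n : ℕ) (s : MvPolynomial (Fin 2) K)
    (hs : X i * s ∈ Ideal.span {planeCubic K ^ n}) : s ∈ Ideal.span {planeCubic K ^ n} := by
  rw [Ideal.mem_span_singleton] at *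
  exact dvd_of_pow_dvd_X_mul i n s hs

theorem colength_X_sup_X_pow {i j : Fin 2} (h : i ≠ j) (n : ℕ) :
    colength K (Ideal.span {(X i : MvPolynomial (Fin 2) K)} ⊔ Ideal.span {X j ^ n}) = n := by
  rw [sup_comm, colength_span_pow_sup K (fun s hs => by
    simpa using mem_span_X_pow_of_mul_mem h 1 s (by simpa using hs))]
  have : Ideal.span {(X j : MvPolynomial (Fin 2) K)} ⊔ Ideal.span {X i} =
      Ideal.span {(X 0 : MvPolynomial (Fin 2) K)} ⊔ Ideal.span {X 1} := by
    fin_cases i <;> fin_cases j <;> simp_all [sup_comm]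
  rw [this, colength_X_sup_X, mul_one]

theorem colength_planeFrobeniusIdeal (q : ℕ) :
    colength K (planeFrobeniusIdeal K q) = ((q * q : ℕ) : ℕ∞) := by
  rw [planeFrobeniusIdeal, Ideal.span_insert,
    colength_span_pow_sup K (mem_span_X_pow_of_mul_mem (by decide) q),
    colength_X_sup_X_pow (by decide)]
  push_cast
  rfl

instance finiteDimensional_planeFrobeniusIdeal (q : ℕ) :
    FiniteDimensional K (MvPolynomial (Fin 2) K ⧸ planeFrobeniusIdeal K q) := by
  have h : Module.length K (MvPolynomial (Fin 2) K ⧸ planeFrobeniusIdeal K q) ≠ ⊤ := by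
    have := colength_planeFrobeniusIdeal (K := K) q
    rw [colength] at this
    rw [this]
    exact ENat.natCast_ne_top _
  rw [Module.length_ne_top_iff, isFiniteLength_iff_isNoetherian_isArtinian] at h
  have := h.1
  infer_instance

/-- Modulo one variable, the r-th power of the cubic is the 3r-th power of the other variable. -/
theorem colength_X_pow_sup_planeCubic_pow (i : Fin 2) (a r : ℕ) :
    colength K (Ideal.span {(X i : MvPolynomial (Fin 2) K) ^ a} ⊔ Ideal.span {planeCubic K ^ r}) =
      ((a * (3 * r) : ℕ) : ℕ∞) := by
  rw [colength_span_pow_sup K (mem_span_planeCubic_pow_of_mul_mem i r)]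
  obtain ⟨j, hij, hj⟩ : ∃ j, i ≠ j ∧ (X i : MvPolynomial (Fin 2) K) ∣ planeCubic K - X j ^ 3 := by
    fin_cases i
    · exact ⟨1, by decide, ⟨X 0 ^ 2, by simp; ring⟩⟩
    · exact ⟨0, by decide, ⟨X 1 ^ 2, by simp; ring⟩⟩
  have h : planeCubic K ^ r - X j ^ (3 * r) ∈ Ideal.span {(X i : MvPolynomial (Fin 2) K)} := by
    rw [Ideal.mem_span_singleton, pow_mul]
    exact hj.trans (sub_dvd_pow_sub_pow _ _ _)
  rw [sup_comm, span_singleton_sup_eq_of_sub_mem h, sup_comm, colength_X_sup_X_pow hij]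
  push_cast
  rfl

theorem isUnit_natCast_of_not_dvd (p : ℕ) [CharP K p] {n : ℕ} (h : ¬ p ∣ n) :
    IsUnit (n : MvPolynomial (Fin 2) K) := by
  rw [← map_natCast (C : K →+* MvPolynomial (Fin 2) K)]
  refine IsUnit.map _ (isUnit_iff_ne_zero.mpr ?_)
  rwa [Ne, CharP.cast_eq_zero_iff K p]

end PlaneCubic

theorem ENat.exists_natCast_eq_of_add_eq {a b : ℕ∞} {n : ℕ} (h : a + b = n) :
    (∃ k : ℕ, a = k) ∧ ∃ k : ℕ, b = k := by
  have ha : a ≠ ⊤ := by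
    rintro rfl
    simp at h
  have hb : b ≠ ⊤ := by
    rintro rfl
    simp at h
  exact ⟨⟨a.toNat, (ENat.natCast_toNat ha).symm⟩, ⟨b.toNat, (ENat.natCast_toNat hb).symm⟩⟩

/-! ### Recursion for the Jordan blocks from q to pq. -/

section PlaneCubicRecursion

open MvPolynomial

variable {K : Type*} [Field K]

theorem planeCubic_ne_zero : planeCubic K ≠ 0 :=
  fun h => not_X_dvd_cube_add_cube (K := K) 0 (by
    rw [planeCubic] at h
    exact h ▸ dvd_zero _)

/-- The rank of multiplication by `(x^3 + y^3)^t` on `K[x, y] / (x^q, y^q)`. -/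
noncomputable def planeRank (K : Type*) [Field K] (q t : ℕ) : ℕ :=
  Module.finrank K (LinearMap.range (mulQuotient K (planeFrobeniusIdeal K q) (planeCubic K) ^ t))

/-- The number of Jordan blocks of size larger than `t` of multiplication by `x^3 + y^3` on
`K[x, y] / (x^q, y^q)`. -/
noncomputable def planeCount (K : Type*) [Field K] (q t : ℕ) : ℕ :=
  jordanCount (mulQuotient K (planeFrobeniusIdeal K q) (planeCubic K)) t

theorem planeRank_succ_le (q t : ℕ) : planeRank K q (t + 1) ≤ planeRank K q t := by
  apply Submodule.finrank_mono
  rw [pow_succ]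
  exact LinearMap.range_comp_le_range _ _

theorem planeCount_add (q t : ℕ) :
    planeCount K q t + planeRank K q (t + 1) = planeRank K q t :=
  Nat.sub_add_cancel (planeRank_succ_le q t)

/-- J is the colon ideal by the s-th power of the cubic. Its colon by the r-th power computes the
rank at s + r, and the drop in rank is the colength of J plus that power. -/
theorem planeRank_add_colength {q s : ℕ} {J : Ideal (MvPolynomial (Fin 2) K)}
    (hJ : ∀ h, planeCubic K ^ s * h ∈ planeFrobeniusIdeal K q ↔ h ∈ J) (r : ℕ) :
    (planeRank K q s : ℕ∞) =
      planeRank K q (s + r) + colength K (J ⊔ Ideal.span {planeCubic K ^ r}) := by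
  have h1 : ∀ h, planeCubic K ^ r * h ∈ J ↔ h ∈ J.colon (Ideal.span {planeCubic K ^ r}) := by
    intro h
    rw [Submodule.mem_colon_span_singleton, smul_eq_mul, mul_comm]
  rw [planeRank, planeRank, finrank_range_mulQuotient_pow K hJ,
    finrank_range_mulQuotient_pow K (J := J.colon (Ideal.span {planeCubic K ^ r})),
    colength_eq_add_of_colon K h1, sup_comm]
  intro h
  rw [← h1, ← hJ, pow_add, mul_assoc]

theorem planeRank_zero (q : ℕ) : planeRank K q 0 = q * q := by
  have := finrank_range_mulQuotient_pow K (I := planeFrobeniusIdeal K q)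
    (J := planeFrobeniusIdeal K q) (g := planeCubic K) (n := 0) (by simp)
  rw [colength_planeFrobeniusIdeal] at this
  exact_mod_cast this

theorem planeRank_add_colength_zero (q r : ℕ) :
    ((q * q : ℕ) : ℕ∞) = planeRank K q r +
      colength K (planeFrobeniusIdeal K q ⊔ Ideal.span {planeCubic K ^ r}) := by
  have := planeRank_add_colength (K := K) (q := q) (s := 0) (J := planeFrobeniusIdeal K q)
    (by simp) r
  rwa [planeRank_zero, zero_add] at this

/-- The hypotheses on the parameters: `q` is a power of the characteristic `p = d₀ + 3 m > 3`. -/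
structure FrobeniusParameters (K : Type*) [Field K] (p d₀ m q : ℕ) : Prop where
  prime : p.Prime
  charP : CharP K p
  d₀_eq : d₀ = 1 ∨ d₀ = 2
  p_eq : p = d₀ + 3 * m
  m_pos : 0 < m
  exists_pow : ∃ e, q = p ^ e

namespace FrobeniusParameters

variable {p d₀ m q : ℕ}

theorem cube_add_cube (h : FrobeniusParameters K p d₀ m q) :
    (X 0 ^ q : MvPolynomial (Fin 2) K) ^ 3 + (X 1 ^ q) ^ 3 = planeCubic K ^ q := by
  have := h.charP
  have : Fact p.Prime := ⟨h.prime⟩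
  obtain ⟨e, rfl⟩ := h.exists_pow
  rw [planeCubic, add_pow_char_pow, ← pow_mul, ← pow_mul, ← pow_mul, ← pow_mul, mul_comm 3]

theorem isUnit_natCast (h : FrobeniusParameters K p d₀ m q) {n : ℕ} (hn : ¬ p ∣ n) :
    IsUnit (n : MvPolynomial (Fin 2) K) :=
  have := h.charP
  isUnit_natCast_of_not_dvd p hn

theorem isUnit_two (h : FrobeniusParameters K p d₀ m q) :
    IsUnit (2 : MvPolynomial (Fin 2) K) := by
  have hd := h.d₀_eq
  have hp := h.p_eq
  have hm := h.m_pos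
  exact_mod_cast h.isUnit_natCast (n := 2) fun h2 => by
    have := Nat.le_of_dvd two_pos h2
    omega

theorem isUnit_two_mul_add_three (h : FrobeniusParameters K p d₀ m q) {k : ℕ} (hk : k < m) :
    IsUnit (2 * ((d₀ + 3 * k : ℕ) : MvPolynomial (Fin 2) K) + 3) := by
  have hd := h.d₀_eq
  have hp := h.p_eq
  exact_mod_cast h.isUnit_natCast (n := 2 * (d₀ + 3 * k) + 3) fun ⟨c, hc⟩ => by
    -- The number 2(d₀ + 3k) + 3 is positive and less than 2p, so divisibility would make it equal
    -- to p = d₀ + 3m. This is impossible modulo 3.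
    have h1 : c < 2 := by
      by_contra! h2
      nlinarith
    interval_cases c <;> omega

theorem isUnit_prod (h : FrobeniusParameters K p d₀ m q) {k : ℕ} (hk : k ≤ m) :
    IsUnit (∏ j ∈ Finset.range k,
      (2 * (2 * ((d₀ + 3 * j : ℕ) : MvPolynomial (Fin 2) K) + 3))) := by
  refine (IsUnit.prod_iff).mpr fun j hj => ?_
  exact h.isUnit_two.mul (h.isUnit_two_mul_add_three ((Finset.mem_range.mp hj).trans_le hk))

/-- The first form of the pair, evaluated at `q`-th powers. -/
noncomputable def A (K : Type*) [Field K] (d₀ q k : ℕ) : MvPolynomial (Fin 2) K :=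
  (fermatPair (X 0 ^ q) (X 1 ^ q) d₀ k).1

/-- The second form of the pair, evaluated at `q`-th powers. -/
noncomputable def B (K : Type*) [Field K] (d₀ q k : ℕ) : MvPolynomial (Fin 2) K :=
  (fermatPair (X 0 ^ q) (X 1 ^ q) d₀ k).2

/-- The ideal generated by the pair, evaluated at `q`-th powers. -/
noncomputable def evenIdeal (K : Type*) [Field K] (d₀ q k : ℕ) : Ideal (MvPolynomial (Fin 2) K) :=
  Ideal.span {A K d₀ q k, B K d₀ q k}

/-- The ideal between two consecutive ideals generated by the pairs. -/
noncomputable def oddIdeal (K : Type*) [Field K] (d₀ q k : ℕ) : Ideal (MvPolynomial (Fin 2) K) :=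
  Ideal.span {X 1 ^ q * A K d₀ q k + X 0 ^ q * B K d₀ q k,
    (X 0 ^ q) ^ 2 * A K d₀ q k - (X 1 ^ q) ^ 2 * B K d₀ q k}

theorem dvd_of_dvd_X_pow_mul (h : FrobeniusParameters K p d₀ m q) (i : Fin 2)
    (s : MvPolynomial (Fin 2) K) (hs : (X 0 ^ q) ^ 3 + (X 1 ^ q) ^ 3 ∣ X i ^ q * s) :
    (X 0 ^ q) ^ 3 + (X 1 ^ q) ^ 3 ∣ s := by
  rw [h.cube_add_cube] at *
  exact dvd_of_pow_dvd_X_pow_mul i q q s hs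

theorem dvd_of_dvd_A_mul (h : FrobeniusParameters K p d₀ m q) {k : ℕ} (hk : k ≤ m)
    (s : MvPolynomial (Fin 2) K) (hs : (X 0 ^ q) ^ 3 + (X 1 ^ q) ^ 3 ∣ A K d₀ q k * s) :
    (X 0 ^ q) ^ 3 + (X 1 ^ q) ^ 3 ∣ s :=
  dvd_of_dvd_fermatPair_mul (h.dvd_of_dvd_X_pow_mul 0) (h.dvd_of_dvd_X_pow_mul 1)
    (h.isUnit_prod hk) s hs

theorem planeCubic_pow_mul_mem_oddIdeal (h : FrobeniusParameters K p d₀ m q) {k : ℕ} (hk : k ≤ m)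
    (s : MvPolynomial (Fin 2) K) :
    planeCubic K ^ q * s ∈ oddIdeal K d₀ q k ↔ s ∈ evenIdeal K d₀ q k := by
  have hG : (X 0 ^ q : MvPolynomial (Fin 2) K) ^ 3 + (X 1 ^ q) ^ 3 ≠ 0 := by
    rw [h.cube_add_cube]
    exact pow_ne_zero _ planeCubic_ne_zero
  rw [← h.cube_add_cube]
  exact mul_mem_span_pair_iff_even hG h.isUnit_two (h.dvd_of_dvd_X_pow_mul 0)
    (h.dvd_of_dvd_X_pow_mul 1) (h.dvd_of_dvd_A_mul hk) (cube_add_cube_dvd_fermatPair _ _ _ _) s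

theorem planeCubic_pow_mul_mem_evenIdeal (h : FrobeniusParameters K p d₀ m q) {k : ℕ} (hk : k < m)
    (s : MvPolynomial (Fin 2) K) :
    planeCubic K ^ q * s ∈ evenIdeal K d₀ q (k + 1) ↔ s ∈ oddIdeal K d₀ q k := by
  have hG : (X 0 ^ q : MvPolynomial (Fin 2) K) ^ 3 + (X 1 ^ q) ^ 3 ≠ 0 := by
    rw [h.cube_add_cube]
    exact pow_ne_zero _ planeCubic_ne_zero
  have hd := h.d₀_eq
  have hp := h.p_eq
  rw [← h.cube_add_cube]
  refine mul_mem_span_pair_iff_odd hG h.isUnit_two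
    (h.dvd_of_dvd_X_pow_mul 1) (h.dvd_of_dvd_A_mul hk.le) (cube_add_cube_dvd_fermatPair _ _ _ _)
    ?_ ?_ (h.isUnit_two_mul_add_three hk) s
  · exact_mod_cast h.isUnit_natCast (n := d₀ + 3 * k + 1)
      fun h2 => by have := Nat.le_of_dvd (by omega) h2; omega
  · exact_mod_cast h.isUnit_natCast (n := d₀ + 3 * k + 2)
      fun h2 => by have := Nat.le_of_dvd (by omega) h2; omega

theorem planeCubic_pow_mem_evenIdeal_zero (h : FrobeniusParameters K p d₀ m q) :
    planeCubic K ^ q ∈ evenIdeal K d₀ q 0 := by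
  rw [← h.cube_add_cube, evenIdeal, A, B, Ideal.mem_span_pair]
  rcases h.d₀_eq with rfl | rfl
  · exact ⟨(X 0 ^ q) ^ 2, (X 1 ^ q) ^ 2, by simp [fermatPair]; ring⟩
  · exact ⟨X 1 ^ q, - X 0 ^ q, by simp [fermatPair]; ring⟩

/-- The substitution x ↦ x^q, y ↦ y^q carries the span identity in degree p to this one. -/
theorem evenIdeal_eq (h : FrobeniusParameters K p d₀ m q) :
    evenIdeal K d₀ q m = planeFrobeniusIdeal K (p * q) := by
  have := h.charP
  have : Fact p.Prime := ⟨h.prime⟩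
  have h1 := congrArg (Ideal.map (aeval (fun i : Fin 2 => (X i ^ q : MvPolynomial (Fin 2) K))))
    (span_fermatPair_eq (K := K) p h.d₀_eq h.p_eq (h.isUnit_prod le_rfl))
  rw [Ideal.map_span, Ideal.map_span, Set.image_pair, Set.image_pair] at h1
  have h2 := map_fermatPair (aeval (fun i : Fin 2 => (X i ^ q : MvPolynomial (Fin 2) K))).toRingHom
    (X 0 : MvPolynomial (Fin 2) K) (X 1) d₀ m
  simp only [AlgHom.toRingHom_eq_coe, RingHom.coe_coe, aeval_X, map_pow] at h1 h2
  rw [h2.1, h2.2] at h1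
  rw [evenIdeal, A, B, h1, ← pow_mul, ← pow_mul, mul_comm]

/-- Starting from the top pair, two colons by the q-th power of the cubic lower the pair index by
one, passing through the odd ideal in between. -/
theorem colon_even (h : FrobeniusParameters K p d₀ m q) {j : ℕ} (hj : j ≤ m)
    (s : MvPolynomial (Fin 2) K) :
    planeCubic K ^ (q * (2 * j)) * s ∈ planeFrobeniusIdeal K (p * q) ↔
      s ∈ evenIdeal K d₀ q (m - j) := by
  induction j generalizing s with
  | zero => simp [h.evenIdeal_eq]
  | succ j ih =>
    rw [show q * (2 * (j + 1)) = q * (2 * j) + q + q by ring, pow_add, pow_add, mul_assoc,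
      mul_assoc, ih (by omega), show m - j = m - (j + 1) + 1 by omega,
      h.planeCubic_pow_mul_mem_evenIdeal (by omega), h.planeCubic_pow_mul_mem_oddIdeal (by omega)]

theorem colon_odd (h : FrobeniusParameters K p d₀ m q) {j : ℕ} (hj : j < m)
    (s : MvPolynomial (Fin 2) K) :
    planeCubic K ^ (q * (2 * j + 1)) * s ∈ planeFrobeniusIdeal K (p * q) ↔
      s ∈ oddIdeal K d₀ q (m - (j + 1)) := by
  rw [show q * (2 * j + 1) = q * (2 * j) + q by ring, pow_add, mul_assoc, h.colon_even hj.le,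
    show m - j = m - (j + 1) + 1 by omega, h.planeCubic_pow_mul_mem_evenIdeal (by omega)]

/-- After 2m colons the ideal of the initial pair is reached, and it contains the q-th power of the
cubic. -/
theorem planeRank_eq_zero (h : FrobeniusParameters K p d₀ m q) {t : ℕ} (ht : q * (2 * m + 1) ≤ t) :
    planeRank K (p * q) t = 0 := by
  have h1 : planeCubic K ^ t ∈ planeFrobeniusIdeal K (p * q) := by
    rw [← Nat.sub_add_cancel ht, pow_add, mul_add, pow_add, mul_one]
    apply Ideal.mul_mem_left
    rw [h.colon_even le_rfl, Nat.sub_self]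
    exact h.planeCubic_pow_mem_evenIdeal_zero
  rw [planeRank, mulQuotient_pow, mulQuotient, Ideal.Quotient.eq_zero_iff_mem.mpr h1]
  simp

theorem planeCount_eq_zero (h : FrobeniusParameters K p d₀ m q) {t : ℕ}
    (ht : q * (2 * m + 1) ≤ t) : planeCount K (p * q) t = 0 := by
  have := planeCount_add (K := K) (p * q) t
  rw [h.planeRank_eq_zero ht] at this
  omega

/-! ### Colengths -/

theorem cube_add_cube_mem (h : FrobeniusParameters K p d₀ m q) {r : ℕ} (hr : r ≤ q)
    {z : MvPolynomial (Fin 2) K} (hz : (X 0 ^ q) ^ 3 + (X 1 ^ q) ^ 3 ∣ z) :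
    z ∈ Ideal.span {planeCubic K ^ r} := by
  rw [Ideal.mem_span_singleton]
  rw [h.cube_add_cube] at hz
  exact (pow_dvd_pow _ hr).trans hz

theorem A_sub_mem (h : FrobeniusParameters K p d₀ m q) {r : ℕ} (hr : r ≤ q) (k : ℕ) :
    A K d₀ q k - (∏ j ∈ Finset.range k,
      (2 * (2 * ((d₀ + 3 * j : ℕ) : MvPolynomial (Fin 2) K) + 3))) *
        ((X 0 ^ q) ^ (3 * k) * A K d₀ q 0) ∈ Ideal.span {planeCubic K ^ r} :=
  h.cube_add_cube_mem hr (fermatPair_fst_congr _ _ _ _)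

theorem mem_of_X_pow_mul_mem (i : Fin 2) (a r : ℕ) (s : MvPolynomial (Fin 2) K)
    (hs : X i ^ a * s ∈ Ideal.span {planeCubic K ^ r}) : s ∈ Ideal.span {planeCubic K ^ r} := by
  rw [Ideal.mem_span_singleton] at *
  exact dvd_of_pow_dvd_X_pow_mul i r a s hs

theorem mem_of_A_mul_mem (h : FrobeniusParameters K p d₀ m q) {r : ℕ} (hr : r ≤ q) {k : ℕ}
    (hk : k ≤ m) (s : MvPolynomial (Fin 2) K)
    (hs : A K d₀ q k * s ∈ Ideal.span {planeCubic K ^ r}) : s ∈ Ideal.span {planeCubic K ^ r} := by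
  have h1 := (Ideal.span {planeCubic K ^ r}).sub_mem hs
    (Ideal.mul_mem_right s _ (h.A_sub_mem hr k))
  rw [← sub_mul, sub_sub_cancel, mul_assoc, mul_assoc, Ideal.unit_mul_mem_iff_mem _ (h.isUnit_prod hk),
    ← pow_mul] at h1
  have h2 := mem_of_X_pow_mul_mem (K := K) 0 _ r _ h1
  rw [A, fermatPair] at h2
  split_ifs at h2
  · exact mem_of_X_pow_mul_mem (K := K) 0 _ r _ h2
  · exact mem_of_X_pow_mul_mem 1 _ r _ (by rwa [← pow_mul] at h2)

theorem colength_A (h : FrobeniusParameters K p d₀ m q) {r : ℕ} (hr : r ≤ q) {k : ℕ}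
    (hk : k ≤ m) : colength K (Ideal.span {A K d₀ q k} ⊔ Ideal.span {planeCubic K ^ r}) =
      (((d₀ + 3 * k) * q * (3 * r) : ℕ) : ℕ∞) := by
  rw [span_singleton_sup_eq_of_sub_mem (h.A_sub_mem hr k),
    Ideal.span_singleton_mul_left_unit (h.isUnit_prod hk), ← pow_mul,
    colength_span_mul_singleton_sup K _ (mem_of_X_pow_mul_mem (K := K) 0 _ r),
    colength_X_pow_sup_planeCubic_pow]
  rcases h.d₀_eq with rfl | rfl
  · rw [A, fermatPair, if_pos rfl, colength_X_pow_sup_planeCubic_pow]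
    norm_cast
    ring
  · rw [A, fermatPair, if_neg (by decide), ← pow_mul, colength_X_pow_sup_planeCubic_pow]
    norm_cast
    ring

/-- Modulo g^r with r ≤ q, the ideals x^q (A, B) and A (x^q, y^q) coincide, because x^q B ≡ y^q A.
-/
theorem colength_evenIdeal (h : FrobeniusParameters K p d₀ m q) {r : ℕ} (hr : r ≤ q) {k : ℕ}
    (hk : k ≤ m) :
    colength K (evenIdeal K d₀ q k ⊔ Ideal.span {planeCubic K ^ r}) + ((q * (3 * r) : ℕ) : ℕ∞) =
      colength K (planeFrobeniusIdeal K q ⊔ Ideal.span {planeCubic K ^ r}) +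
        (((d₀ + 3 * k) * q * (3 * r) : ℕ) : ℕ∞) := by
  rw [← h.colength_A hr hk, ← colength_X_pow_sup_planeCubic_pow (K := K) 0 q r]
  refine colength_add_eq_of_proportional K (mem_of_X_pow_mul_mem (K := K) 0 _ r)
    (h.mem_of_A_mul_mem hr hk) (by simp [mul_comm]) ?_
  rw [mul_comm (A K d₀ q k)]
  exact h.cube_add_cube_mem hr (cube_add_cube_dvd_fermatPair _ _ _ _)

theorem C_sub_mem (h : FrobeniusParameters K p d₀ m q) {r : ℕ} (hr : r ≤ q) (k : ℕ) :
    X 1 ^ q * A K d₀ q k + X 0 ^ q * B K d₀ q k - 2 * (X 1 ^ q * A K d₀ q k) ∈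
      Ideal.span {planeCubic K ^ r} := by
  rw [show X 1 ^ q * A K d₀ q k + X 0 ^ q * B K d₀ q k - 2 * (X 1 ^ q * A K d₀ q k) =
    X 0 ^ q * B K d₀ q k - X 1 ^ q * A K d₀ q k by ring]
  exact h.cube_add_cube_mem hr (cube_add_cube_dvd_fermatPair _ _ _ _)

/-- Modulo x^q one has g^q ≡ y^(3q), so g^(q-r) (y^(2q), g^r) and y^(2q) (g^(q-r), y^q) agree. This
trades the ideal for (x^q, y^q, g^(q-r)), whose colength is q^2 minus a rank; it is the source of
the reversal r ↦ q - r on odd strips. -/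
theorem colength_X_pow_sup_X_sq (h : FrobeniusParameters K p d₀ m q) {r : ℕ} (hr : r ≤ q) :
    colength K (Ideal.span {X 0 ^ q, -(X 1 ^ q) ^ 2} ⊔ Ideal.span {planeCubic K ^ r}) +
      planeRank K q (q - r) = ((q * (3 * r) : ℕ) : ℕ∞) := by
  have h1 := colength_add_eq_of_proportional K (G := Ideal.span {(X 0 : MvPolynomial (Fin 2) K) ^ q})
    (a := planeCubic K ^ (q - r)) (b₁ := (X 1 ^ q) ^ 2) (b₂ := planeCubic K ^ r)
    (c := (X 1 ^ q) ^ 2) (c₁ := planeCubic K ^ (q - r)) (c₂ := X 1 ^ q)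
    (pow_mul_mem_imp (mem_span_X_pow_of_planeCubic_mul_mem 0 q) _)
    (pow_mul_mem_imp (pow_mul_mem_imp (mem_span_X_pow_of_mul_mem (by decide) q) _) _)
    (by rw [mul_comm, sub_self]; exact Ideal.zero_mem _)
    (by
      rw [← pow_add, Nat.sub_add_cancel hr, ← h.cube_add_cube, Ideal.mem_span_singleton]
      exact ⟨(X 0 ^ q) ^ 2, by ring⟩)
  have e1 : Ideal.span {((X 1 : MvPolynomial (Fin 2) K) ^ q) ^ 2, planeCubic K ^ r} ⊔
      Ideal.span {X 0 ^ q} =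
      Ideal.span {X 0 ^ q, -(X 1 ^ q) ^ 2} ⊔ Ideal.span {planeCubic K ^ r} := by
    simp only [Ideal.span_insert, Ideal.span_singleton_neg]
    rw [sup_comm (Ideal.span {X 0 ^ q}), sup_right_comm]
  have e2 : Ideal.span {planeCubic K ^ (q - r), X 1 ^ q} ⊔ Ideal.span {X 0 ^ q} =
      planeFrobeniusIdeal K q ⊔ Ideal.span {planeCubic K ^ (q - r)} := by
    simp only [Ideal.span_insert, planeFrobeniusIdeal]
    ac_rfl
  have h2 := planeRank_add_colength_zero (K := K) q (q - r)
  rw [e1, e2, sup_comm (Ideal.span {planeCubic K ^ (q - r)}), colength_X_pow_sup_planeCubic_pow]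
    at h1
  generalize colength K (planeFrobeniusIdeal K q ⊔ _) = F at h1 h2
  generalize
    colength K (Ideal.span ({X 0 ^ q, -(X 1 ^ q) ^ 2} : Set (MvPolynomial (Fin 2) K)) ⊔ _) = E at h1 ⊢
  rw [← pow_mul, sup_comm, colength_span_pow_sup K (mem_span_X_pow_of_mul_mem (by decide) _),
    colength_X_sup_X_pow (by decide)] at h1
  generalize planeRank K q (q - r) = R at h2 ⊢
  obtain ⟨F, rfl⟩ := (ENat.exists_natCast_eq_of_add_eq h2.symm).2
  norm_cast at h1 h2
  obtain ⟨E, rfl⟩ := (ENat.exists_natCast_eq_of_add_eq h1).1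
  norm_cast at h1 ⊢
  obtain ⟨r', rfl⟩ := Nat.exists_eq_add_of_le hr
  rw [Nat.add_sub_cancel_left] at h1
  linarith

/-- With C the first generator of the odd ideal, x^q times that ideal agrees with C (x^q, -y^(2q))
modulo g^r. Moreover C ≡ 2 y^q A, so its colength is known. -/
theorem colength_oddIdeal (h : FrobeniusParameters K p d₀ m q) {r : ℕ} (hr : r ≤ q) {k : ℕ}
    (hk : k ≤ m) :
    colength K (oddIdeal K d₀ q k ⊔ Ideal.span {planeCubic K ^ r}) + planeRank K q (q - r) =
        (((d₀ + 3 * k + 1) * q * (3 * r) : ℕ) : ℕ∞) := by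
  have hC : ∀ s, (X 1 ^ q * A K d₀ q k + X 0 ^ q * B K d₀ q k) * s ∈
      Ideal.span {planeCubic K ^ r} → s ∈ Ideal.span {planeCubic K ^ r} := by
    intro s hs
    have h1 := (Ideal.span {planeCubic K ^ r}).sub_mem hs (Ideal.mul_mem_right s _ (h.C_sub_mem hr k))
    rw [← sub_mul, sub_sub_cancel, mul_assoc, mul_assoc,
      Ideal.unit_mul_mem_iff_mem _ h.isUnit_two] at h1
    exact h.mem_of_A_mul_mem hr hk s (mem_of_X_pow_mul_mem (K := K) 1 _ r _ h1)
  have h1 := colength_add_eq_of_proportional K (G := Ideal.span {planeCubic K ^ r})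
    (a := X 0 ^ q) (b₁ := X 1 ^ q * A K d₀ q k + X 0 ^ q * B K d₀ q k)
    (b₂ := (X 0 ^ q) ^ 2 * A K d₀ q k - (X 1 ^ q) ^ 2 * B K d₀ q k)
    (c := X 1 ^ q * A K d₀ q k + X 0 ^ q * B K d₀ q k) (c₁ := X 0 ^ q) (c₂ := -(X 1 ^ q) ^ 2)
    (mem_of_X_pow_mul_mem 0 _ r) hC (by rw [mul_comm, sub_self]; exact Ideal.zero_mem _)
    (h.cube_add_cube_mem hr (Dvd.intro (A K d₀ q k) (by ring)))
  rw [colength_X_pow_sup_planeCubic_pow, span_singleton_sup_eq_of_sub_mem (h.C_sub_mem hr k),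
    Ideal.span_singleton_mul_left_unit h.isUnit_two,
    colength_span_mul_singleton_sup K _ (mem_of_X_pow_mul_mem 1 _ r),
    colength_X_pow_sup_planeCubic_pow, h.colength_A hr hk] at h1
  have h2 := h.colength_X_pow_sup_X_sq hr
  rw [oddIdeal]
  generalize
    colength K (Ideal.span ({X 0 ^ q, -(X 1 ^ q) ^ 2} : Set (MvPolynomial (Fin 2) K)) ⊔ _) = F at h1 h2
  generalize colength K (Ideal.span ({X 1 ^ q * A K d₀ q k + X 0 ^ q * B K d₀ q k, _} :
    Set (MvPolynomial (Fin 2) K)) ⊔ _) = E at h1 ⊢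
  generalize planeRank K q (q - r) = R at h2 ⊢
  obtain ⟨F, rfl⟩ := (ENat.exists_natCast_eq_of_add_eq h2).1
  norm_cast at h1 h2
  obtain ⟨E, rfl⟩ := (ENat.exists_natCast_eq_of_add_eq h1).1
  norm_cast at h1 ⊢
  linarith

/-- Block counts are first differences of ranks, so the colength formula is evaluated at r and r + 1
and subtracted. -/
theorem planeCount_even (h : FrobeniusParameters K p d₀ m q) {j r : ℕ} (hj : j ≤ m) (hr : r < q) :
    planeCount K (p * q) (q * (2 * j) + r) + 3 * q =
      planeCount K q r + 3 * q * (d₀ + 3 * (m - j)) := by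
  have key : ∀ r ≤ q, planeRank K (p * q) (q * (2 * j)) + planeRank K q r +
      q * (3 * r) =
      planeRank K (p * q) (q * (2 * j) + r) + q * q + (d₀ + 3 * (m - j)) * q * (3 * r) := by
    intro r hr
    have h1 := planeRank_add_colength (fun s => h.colon_even hj s) r
    have h2 := planeRank_add_colength_zero (K := K) q r
    have h3 := h.colength_evenIdeal hr (Nat.sub_le m j)
    obtain ⟨F, hF⟩ := (ENat.exists_natCast_eq_of_add_eq h2.symm).2
    obtain ⟨E, hE⟩ := (ENat.exists_natCast_eq_of_add_eq h1.symm).2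
    rw [hE] at h1 h3
    rw [hF] at h2 h3
    norm_cast at h1 h2 h3
    linarith
  have h1 := key r hr.le
  have h2 := key (r + 1) hr
  have h3 := planeCount_add (K := K) (p * q) (q * (2 * j) + r)
  have h4 := planeCount_add (K := K) q r
  have h5 := planeRank_succ_le (K := K) q r
  have h6 := planeRank_succ_le (K := K) (p * q) (q * (2 * j) + r)
  rw [← add_assoc] at h2
  linarith

theorem planeCount_odd (h : FrobeniusParameters K p d₀ m q) {j r : ℕ} (hj : j < m) (hr : r < q) :
    planeCount K (p * q) (q * (2 * j + 1) + r) + planeCount K q (q - 1 - r) =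
      3 * q * (d₀ + 3 * (m - (j + 1)) + 1) := by
  have key : ∀ r ≤ q, planeRank K (p * q) (q * (2 * j + 1)) + planeRank K q (q - r) =
      planeRank K (p * q) (q * (2 * j + 1) + r) + (d₀ + 3 * (m - (j + 1)) + 1) * q * (3 * r) := by
    intro r hr
    have h1 := planeRank_add_colength (fun s => h.colon_odd hj s) r
    have h2 := h.colength_oddIdeal hr (Nat.sub_le m (j + 1))
    obtain ⟨E, hE⟩ := (ENat.exists_natCast_eq_of_add_eq h1.symm).2
    rw [hE] at h1 h2
    norm_cast at h1 h2
    linarith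
  have h1 := key r hr.le
  have h2 := key (r + 1) hr
  have h3 := planeCount_add (K := K) (p * q) (q * (2 * j + 1) + r)
  have h4 := planeCount_add (K := K) q (q - 1 - r)
  rw [show q - 1 - r + 1 = q - r by omega] at h4
  rw [← add_assoc, show q - (r + 1) = q - 1 - r by omega] at h2
  linarith

/-- The sum telescopes from the full dimension q^2 to rank zero: the q-th power of the cubic is
x^(3q) + y^(3q), which lies in (x^q, y^q). -/
theorem sum_planeCount (h : FrobeniusParameters K p d₀ m q) :
    ∑ t ∈ Finset.range q, planeCount K q t = q * q := by
  have h0 : planeRank K q q = 0 := by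
    have h1 : planeCubic K ^ q ∈ planeFrobeniusIdeal K q := by
      rw [← h.cube_add_cube, planeFrobeniusIdeal, Ideal.mem_span_pair]
      exact ⟨(X 0 ^ q) ^ 2, (X 1 ^ q) ^ 2, by ring⟩
    rw [planeRank, mulQuotient_pow, mulQuotient, Ideal.Quotient.eq_zero_iff_mem.mpr h1]
    simp
  have h1 : ∀ n, ∑ t ∈ Finset.range n, planeCount K q t + planeRank K q n = planeRank K q 0 := by
    intro n
    induction n with
    | zero => simp
    | succ n ih =>
      rw [Finset.sum_range_succ, ← ih, ← planeCount_add q n]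
      ring
  rw [← planeRank_zero (K := K), ← h1 q, h0, add_zero]

end FrobeniusParameters

end PlaneCubicRecursion

/-! ### The recursion for the convolution. -/

theorem sum_range_mul_eq_sum_sum {M : Type*} [AddCommMonoid M] (f : ℕ → M) (n q : ℕ) :
    ∑ t ∈ Finset.range (n * q), f t =
      ∑ i ∈ Finset.range n, ∑ r ∈ Finset.range q, f (q * i + r) := by
  induction n with
  | zero => simp
  | succ n ih => rw [Nat.succ_mul, Finset.sum_range_add, ih, Finset.sum_range_succ, mul_comm n q]

theorem sum_range_two_mul_add_one {M : Type*} [AddCommMonoid M] (f : ℕ → M) (k : ℕ) :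
    ∑ i ∈ Finset.range (2 * k + 1), f i =
      ∑ j ∈ Finset.range (k + 1), f (2 * j) + ∑ j ∈ Finset.range k, f (2 * j + 1) := by
  induction k with
  | zero => simp
  | succ k ih =>
    rw [show 2 * (k + 1) + 1 = 2 * k + 1 + 1 + 1 by ring, Finset.sum_range_succ,
      Finset.sum_range_succ, ih, Finset.sum_range_succ (fun j => f (2 * j)) (k + 1),
      Finset.sum_range_succ (fun j => f (2 * j + 1)) k, show 2 * (k + 1) = 2 * k + 1 + 1 by ring]
    generalize f (2 * k + 1 + 1) = a
    generalize f (2 * k + 1) = b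
    abel

theorem sum_range_quadratic (a b c : ℚ) (n : ℕ) :
    ∑ j ∈ Finset.range n, (a + b * j + c * j ^ 2) =
      a * n + b * (n * (n - 1) / 2) + c * ((n - 1) * n * (2 * n - 1) / 6) := by
  induction n with
  | zero => simp
  | succ n ih =>
    rw [Finset.sum_range_succ, ih]
    push_cast
    ring

section PlaneConvolution

variable (K : Type*) [Field K]

/-- The number of Jordan blocks of maximal size `q` of multiplication by the Fermat cubic in four
variables on `K[x₁, x₂, x₃, x₄] / (x₁^q, x₂^q, x₃^q, x₄^q)`. -/
noncomputable def planeConvolution (q : ℕ) : ℕ :=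
  ∑ t ∈ Finset.range q, planeCount K q t * planeCount K q (q - 1 - t)

variable {K}

/-- Index t = qi + r is complementary to q(p-1-i) + (q-1-r), and i and p-1-i have the same parity,
so two even or two odd strips meet. Each surviving pair of strips gives one copy of the convolution
for q plus terms determined by ∑ N = q^2. There are 2k + 1 = m + 2 - d₀ surviving values of i. -/
theorem planeConvolution_mul_p {p d₀ m q : ℕ} (h : FrobeniusParameters K p d₀ m q) :
    8 * (planeConvolution K (p * q) : ℤ) =
      8 * (m + 2 - d₀) * planeConvolution K q + (q : ℤ) ^ 3 * ((p : ℤ) ^ 3 - p) := by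
  have hq : 0 < q := by
    obtain ⟨e, rfl⟩ := h.exists_pow
    exact pow_pos h.prime.pos e
  -- Oddness of p = d₀ + 3m forces m and d₀ - 1 to have the same parity.
  obtain ⟨k, hk⟩ : ∃ k, m = 2 * k + d₀ - 1 := by
    have hodd : p % 2 = 1 := by
      have := h.prime.eq_two_or_odd
      have := h.p_eq
      have := h.d₀_eq
      have := h.m_pos
      omega
    have := h.p_eq
    rcases h.d₀_eq with h1 | h1
    · exact ⟨m / 2, by omega⟩
    · exact ⟨m / 2, by omega⟩
  obtain ⟨l, hl⟩ : ∃ l, l = k + d₀ - 1 := ⟨_, rfl⟩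
  have hd := h.d₀_eq
  -- The range of i splits into a middle block and two outer blocks of length 2l = p - 1 - 2m. On
  -- each outer block one of the two complementary strips lies beyond 2m and contributes zero.
  have hp : p = 2 * l + (2 * k + 1) + 2 * l := by
    have := h.p_eq
    omega
  let N : ℕ → ℤ := fun t => planeCount K q t
  have hN : ∑ r ∈ Finset.range q, N r = q * q := by
    simp only [N]
    exact_mod_cast h.sum_planeCount
  have hN' : ∑ r ∈ Finset.range q, N (q - 1 - r) = q * q := by
    rw [Finset.sum_range_reflect, hN]
  have hNN : ∑ r ∈ Finset.range q, N r * N (q - 1 - r) = planeConvolution K q := by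
    simp [N, planeConvolution]
  let term : ℕ → ℤ := fun i => ∑ r ∈ Finset.range q,
    (planeCount K (p * q) (q * i + r) : ℤ) * planeCount K (p * q) (q * (p - 1 - i) + (q - 1 - r))
  have hsum : (planeConvolution K (p * q) : ℤ) = ∑ i ∈ Finset.range p, term i := by
    rw [planeConvolution, sum_range_mul_eq_sum_sum]
    push_cast
    refine Finset.sum_congr rfl fun i hi => Finset.sum_congr rfl fun r hr => ?_
    rw [Finset.mem_range] at hi hr
    congr 3
    obtain ⟨c, rfl⟩ : ∃ c, p = i + 1 + c := Nat.exists_eq_add_of_le hi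
    obtain ⟨c', rfl⟩ : ∃ c, q = r + 1 + c := Nat.exists_eq_add_of_le hr
    rw [show i + 1 + c - 1 - i = c by omega, show r + 1 + c' - 1 - r = c' by omega]
    rw [Nat.sub_sub, Nat.sub_eq_iff_eq_add]
    · ring
    · nlinarith
  have hzero : ∀ i, 2 * m + 1 ≤ i → ∀ r, planeCount K (p * q) (q * i + r) = 0 := by
    intro i hi r
    apply h.planeCount_eq_zero
    exact (Nat.mul_le_mul_left q hi).trans (Nat.le_add_right _ _)
  have hlow : ∀ i < 2 * l, term i = 0 := by
    intro i hi
    refine Finset.sum_eq_zero fun r _ => ?_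
    rw [hzero (p - 1 - i) (by omega)]
    simp
  have hhigh : ∀ i, term (2 * l + (2 * k + 1) + i) = 0 := by
    intro i
    refine Finset.sum_eq_zero fun r _ => ?_
    rw [hzero (2 * l + (2 * k + 1) + i) (by omega)]
    simp
  have heven : ∀ j < k + 1, term (2 * l + 2 * j) = planeConvolution K q +
      (q : ℤ) ^ 3 * (3 * (2 * (d₀ - 1) + 3 * k) + 9 * (d₀ - 1 + 3 * (k - j)) * (d₀ - 1 + 3 * j)) := by
    intro j hj
    have h1 : ∀ r ∈ Finset.range q, (planeCount K (p * q) (q * (2 * l + 2 * j) + r) : ℤ) *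
        planeCount K (p * q) (q * (p - 1 - (2 * l + 2 * j)) + (q - 1 - r)) =
        N r * N (q - 1 - r) + (3 * q * (d₀ - 1 + 3 * (k - j))) * N (q - 1 - r) +
        (3 * q * (d₀ - 1 + 3 * j)) * N r +
          (3 * q * (d₀ - 1 + 3 * (k - j))) * (3 * q * (d₀ - 1 + 3 * j)) := by
      intro r hr
      rw [Finset.mem_range] at hr
      have e1 := h.planeCount_even (j := l + j) (r := r) (by omega) hr
      have e2 := h.planeCount_even (j := l + (k - j)) (r := q - 1 - r) (by omega) (by omega)
      rw [show m - (l + j) = k - j by omega, mul_add 2 l] at e1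
      rw [show m - (l + (k - j)) = j by omega,
        show 2 * (l + (k - j)) = p - 1 - (2 * l + 2 * j) by omega] at e2
      zify [show j ≤ k by omega] at e1 e2
      rw [eq_sub_of_add_eq e1, eq_sub_of_add_eq e2]
      simp only [N]
      ring
    simp only [term]
    rw [Finset.sum_congr rfl h1]
    simp only [Finset.sum_add_distrib, ← Finset.mul_sum, hN, hN', hNN, Finset.sum_const,
      Finset.card_range, nsmul_eq_mul]
    ring
  have hodd : ∀ j < k, term (2 * l + (2 * j + 1)) = planeConvolution K q +
      (q : ℤ) ^ 3 * (-3 * (2 * (d₀ - 1) + 3 * k + 1) +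
        9 * (d₀ + 1 + 3 * (k - 1 - j)) * (d₀ + 1 + 3 * j)) := by
    intro j hj
    have h1 : ∀ r ∈ Finset.range q, (planeCount K (p * q) (q * (2 * l + (2 * j + 1)) + r) : ℤ) *
        planeCount K (p * q) (q * (p - 1 - (2 * l + (2 * j + 1))) + (q - 1 - r)) =
        N r * N (q - 1 - r) - (3 * q * (d₀ + 1 + 3 * (k - 1 - j))) * N r -
        (3 * q * (d₀ + 1 + 3 * j)) * N (q - 1 - r) +
          (3 * q * (d₀ + 1 + 3 * (k - 1 - j))) * (3 * q * (d₀ + 1 + 3 * j)) := by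
      intro r hr
      rw [Finset.mem_range] at hr
      have e1 := h.planeCount_odd (j := l + j) (r := r) (by omega) hr
      have e2 := h.planeCount_odd (j := l + (k - 1 - j)) (r := q - 1 - r) (by omega) (by omega)
      rw [show m - (l + j + 1) = k - 1 - j by omega,
        show 2 * (l + j) + 1 = 2 * l + (2 * j + 1) by ring] at e1
      rw [show m - (l + (k - 1 - j) + 1) = j by omega,
        show 2 * (l + (k - 1 - j)) + 1 = p - 1 - (2 * l + (2 * j + 1)) by omega,
        show q - 1 - (q - 1 - r) = r by omega] at e2
      zify [show j ≤ k - 1 by omega, show 1 ≤ k by omega] at e1 e2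
      rw [eq_sub_of_add_eq e1, eq_sub_of_add_eq e2]
      simp only [N]
      ring
    simp only [term]
    rw [Finset.sum_congr rfl h1]
    simp only [Finset.sum_add_distrib, Finset.sum_sub_distrib, ← Finset.mul_sum, hN, hN', hNN,
      Finset.sum_const, Finset.card_range, nsmul_eq_mul]
    ring
  have hsplit : ∑ i ∈ Finset.range p, term i =
      ∑ j ∈ Finset.range (k + 1), term (2 * l + 2 * j) +
        ∑ j ∈ Finset.range k, term (2 * l + (2 * j + 1)) := by
    rw [hp, Finset.sum_range_add, Finset.sum_range_add,
      Finset.sum_eq_zero (fun i hi => hlow i (Finset.mem_range.mp hi)),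
      Finset.sum_eq_zero (fun i _ => hhigh i), zero_add, add_zero,
      sum_range_two_mul_add_one (fun i => term (2 * l + i))]
  rw [hsum, hsplit, Finset.sum_congr rfl (fun j hj => heven j (Finset.mem_range.mp hj)),
    Finset.sum_congr rfl (fun j hj => hodd j (Finset.mem_range.mp hj))]
  rw [← Int.cast_inj (α := ℚ)]
  push_cast
  generalize (planeConvolution K q : ℚ) = F
  -- The remaining summands are quadratic polynomials in j; the constants are their coefficients for
  -- the even and the odd strips.
  have hsum1 := sum_range_quadratic
    (F + (q : ℚ) ^ 3 * (3 * (2 * (d₀ - 1) + 3 * k) + 9 * (d₀ - 1 + 3 * k) * (d₀ - 1)))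
    ((q : ℚ) ^ 3 * 81 * k) (-(q : ℚ) ^ 3 * 81) (k + 1)
  have hsum2 := sum_range_quadratic
    (F + (q : ℚ) ^ 3 * (-3 * (2 * (d₀ - 1) + 3 * k + 1) +
      9 * (d₀ + 1 + 3 * (k - 1)) * (d₀ + 1)))
    ((q : ℚ) ^ 3 * 81 * (k - 1)) (-(q : ℚ) ^ 3 * 81) k
  rw [Finset.sum_congr rfl (g := fun j : ℕ => (F + (q : ℚ) ^ 3 * (3 * (2 * (d₀ - 1) + 3 * k) +
    9 * (d₀ - 1 + 3 * k) * (d₀ - 1))) + ((q : ℚ) ^ 3 * 81 * k) * j + (-(q : ℚ) ^ 3 * 81) * j ^ 2)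
    (fun j _ => by ring), hsum1,
    Finset.sum_congr rfl (g := fun j : ℕ => (F + (q : ℚ) ^ 3 * (-3 * (2 * (d₀ - 1) + 3 * k + 1) +
      9 * (d₀ + 1 + 3 * (k - 1)) * (d₀ + 1))) + ((q : ℚ) ^ 3 * 81 * (k - 1)) * j +
        (-(q : ℚ) ^ 3 * 81) * j ^ 2) (fun j _ => by ring), hsum2]
  rcases hd with hd | hd
  · rw [hp, hk, hl, hd]
    simp only [Nat.add_sub_cancel]
    push_cast
    ring
  · rw [hp, hk, hl, hd, show 2 * k + 2 - 1 = 2 * k + 1 by omega, show k + 2 - 1 = k + 1 by omega]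
    push_cast
    ring

end PlaneConvolution

/-! ### Ranks and dual systems. -/

section DualSystem

variable {K V : Type*} [Field K] [AddCommGroup V] [Module K V] [FiniteDimensional K V]

/-- A dual system forces the vectors Θ (h i) to be independent. Conversely, choose independent
vectors in the range and represent their dual functionals through the perfect pairing E. -/
theorem exists_dual_system_iff_le_finrank_range (E : V ≃ₗ[K] Module.Dual K V)
    (hE : ∀ v w, E v w = E w v) (Θ : Module.End K V) (n : ℕ) :
    (∃ h r : Fin n → V, ∀ i j, E (Θ (h i)) (r j) = if i = j then 1 else 0) ↔
      n ≤ Module.finrank K (LinearMap.range Θ) := by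
  constructor
  · rintro ⟨h, r, hr⟩
    have hli : LinearIndependent K fun i => Θ (h i) := by
      refine LinearIndependent.of_pairwise_dual_eq_zero_one _ (fun j => E (r j)) ?_ ?_
      · intro i j hij
        rw [hE, hr, if_neg hij.symm]
      · intro i
        rw [hE, hr, if_pos rfl]
    have hli' : LinearIndependent K fun i => (⟨Θ (h i), ⟨_, rfl⟩⟩ : LinearMap.range Θ) :=
      LinearIndependent.of_comp (LinearMap.range Θ).subtype hli
    simpa using hli'.fintype_card_le_finrank
  · intro hn
    let b := Module.finBasis K (LinearMap.range Θ)
    let w : Fin n → V := fun i => b (Fin.castLE hn i)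
    have hw : LinearIndependent K w :=
      (b.linearIndependent.comp _ (Fin.castLE_injective hn)).map' (LinearMap.range Θ).subtype
        (Submodule.ker_subtype _)
    obtain ⟨F, hF⟩ := (Fintype.linearCombination K w).exists_leftInverse_of_injective
      (LinearMap.ker_eq_bot'.mpr fun g hg => funext (Fintype.linearIndependent_iff.mp hw g hg))
    have hFw : ∀ i, F (w i) = Pi.single i 1 := by
      intro i
      have := LinearMap.congr_fun hF (Pi.single i 1)
      simpa using this
    choose h hh using fun i => (b (Fin.castLE hn i)).2
    refine ⟨h, fun j => E.symm (LinearMap.proj j ∘ₗ F), fun i j => ?_⟩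
    rw [hh, hE, LinearEquiv.apply_symm_apply]
    change F (w i) j = _
    rw [hFw, Pi.single_apply]
    exact if_congr eq_comm rfl rfl

end DualSystem

/-- The geometric sum times -a - b is (-a)^q - b^q = (-a-b)^q with q = p^e; cancel one factor and
use that q - 1 is even. -/
theorem sum_neg_one_pow_mul_eq_add_pow {A : Type*} [CommRing A] [IsDomain A] (p e : ℕ)
    [Fact p.Prime] [CharP A p] (hp : p ≠ 2) {a b : A} (hab : a + b ≠ 0) :
    ∑ s ∈ Finset.range (p ^ e), (-1) ^ s * (a ^ s * b ^ (p ^ e - 1 - s)) =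
      (a + b) ^ (p ^ e - 1) := by
  have hodd : Odd (p ^ e) := ((Fact.out : p.Prime).odd_of_ne_two hp).pow
  have h1 := geom_sum₂_mul (-a) b (p ^ e)
  rw [← sub_pow_char_pow] at h1
  have h2 : -a - b ≠ 0 := fun h => hab (by linear_combination -h)
  have h3 : (-a - b) ^ (p ^ e) = (-a - b) ^ (p ^ e - 1) * (-a - b) := by
    rw [← pow_succ, Nat.sub_add_cancel hodd.pos]
  rw [h3] at h1
  have h4 := mul_right_cancel₀ h2 h1
  have h5 : Even (p ^ e - 1) := by
    obtain ⟨c, hc⟩ := hodd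
    exact ⟨c, by omega⟩
  rw [show a + b = -(-a - b) by ring, h5.neg_pow, ← h4]
  refine Finset.sum_congr rfl fun s _ => ?_
  rw [neg_pow a]
  ring

/-! ### From the top coefficient in four variables to the tensor square. -/

section PlaneForm

open MvPolynomial TensorProduct

variable (K : Type*) [Field K]

/-- The exponent vector `(q - 1, …, q - 1)`. -/
noncomputable def topExponent (σ : Type*) [Finite σ] (q : ℕ) : σ →₀ ℕ :=
  Finsupp.equivFunOnFinite.symm fun _ => q - 1

@[simp]
theorem topExponent_apply (σ : Type*) [Finite σ] (q : ℕ) (i : σ) : topExponent σ q i = q - 1 := rfl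

theorem mem_planeFrobeniusIdeal_iff (q : ℕ) (u : MvPolynomial (Fin 2) K) :
    u ∈ planeFrobeniusIdeal K q ↔ ∀ n, (∀ i, n i < q) → coeff n u = 0 := by
  have h : ({X 0 ^ q, X 1 ^ q} : Set (MvPolynomial (Fin 2) K)) =
      (fun s => monomial s (1 : K)) '' Set.range fun i : Fin 2 => Finsupp.single i q := by
    ext z
    simp [Fin.exists_fin_two, X_pow_eq_monomial, eq_comm]
  rw [planeFrobeniusIdeal, h, mem_ideal_span_monomial_image]
  constructor
  · intro hu n hn
    by_contra hne
    obtain ⟨_, ⟨i, rfl⟩, hi⟩ := hu n (mem_support_iff.mpr hne)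
    have := hi i
    simp only [Finsupp.single_eq_same] at this
    exact absurd (hn i) (not_lt.mpr this)
  · intro hu n hn
    by_contra! hcon
    refine mem_support_iff.mp hn (hu n fun i => ?_)
    have := hcon _ ⟨i, rfl⟩
    rw [Finsupp.single_le_iff] at this
    omega

/-- The functional on `K[x, y] / (x^q, y^q)` that reads off the coefficient of
`x^(q-1) y^(q-1)`. -/
noncomputable def planeFunctional (q : ℕ) (hq : 0 < q) :
    (MvPolynomial (Fin 2) K ⧸ planeFrobeniusIdeal K q) →ₗ[K] K :=
  ((planeFrobeniusIdeal K q).restrictScalars K).liftQ (lcoeff K (topExponent (Fin 2) q)) (by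
    intro u hu
    exact (mem_planeFrobeniusIdeal_iff K q u).mp hu _ fun i => by
      rw [topExponent_apply]; omega)

variable {K}

theorem planeFunctional_mk (q : ℕ) (hq : 0 < q) (u : MvPolynomial (Fin 2) K) :
    planeFunctional K q hq (Ideal.Quotient.mk _ u) = coeff (topExponent (Fin 2) q) u := rfl

/-- Multiplication by the complementary monomial moves any coefficient with exponents below q to the
top position. -/
theorem planeFunctional_nondegenerate (q : ℕ) (hq : 0 < q)
    (w : MvPolynomial (Fin 2) K ⧸ planeFrobeniusIdeal K q)
    (hw : ∀ w', planeFunctional K q hq (w * w') = 0) : w = 0 := by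
  obtain ⟨u, rfl⟩ := Ideal.Quotient.mk_surjective w
  rw [Ideal.Quotient.eq_zero_iff_mem, mem_planeFrobeniusIdeal_iff]
  intro n hn
  have := hw (Ideal.Quotient.mk _ (monomial (topExponent (Fin 2) q - n) 1))
  rw [← map_mul, planeFunctional_mk] at this
  have hle : n ≤ topExponent (Fin 2) q := fun i => by
    have := hn i
    rw [topExponent_apply]
    omega
  rw [coeff_mul_monomial', if_pos tsub_le_self, tsub_tsub_cancel_of_le hle, mul_one] at this
  exact this

/-- The duality `w ↦ (w' ↦ λ (w w'))` of `K[x, y] / (x^q, y^q)`. -/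
noncomputable def planeDuality (q : ℕ) (hq : 0 < q) :
    (MvPolynomial (Fin 2) K ⧸ planeFrobeniusIdeal K q) ≃ₗ[K]
      Module.Dual K (MvPolynomial (Fin 2) K ⧸ planeFrobeniusIdeal K q) :=
  LinearEquiv.ofInjectiveOfFinrankEq ((LinearMap.mul K _).compr₂ (planeFunctional K q hq)) (by
    rw [injective_iff_map_eq_zero]
    intro w hw
    exact planeFunctional_nondegenerate q hq w fun w' => LinearMap.congr_fun hw w')
    Subspace.dual_finrank_eq.symm

theorem planeDuality_apply (q : ℕ) (hq : 0 < q)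
    (w w' : MvPolynomial (Fin 2) K ⧸ planeFrobeniusIdeal K q) :
    planeDuality q hq w w' = planeFunctional K q hq (w * w') := rfl

variable (K) in
/-- The quotient ring `K[x, y] / (x^q, y^q)`. -/
abbrev PlaneQuotient (q : ℕ) : Type _ := MvPolynomial (Fin 2) K ⧸ planeFrobeniusIdeal K q

noncomputable instance (q : ℕ) : CommRing (PlaneQuotient K q ⊗[K] PlaneQuotient K q) :=
  Algebra.TensorProduct.instCommRing

/-- The product of two copies of the functional `planeFunctional`. -/
noncomputable def tensorFunctional (q : ℕ) (hq : 0 < q) :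
    PlaneQuotient K q ⊗[K] PlaneQuotient K q →ₗ[K] K :=
  LinearMap.mul' K K ∘ₗ TensorProduct.map (planeFunctional K q hq) (planeFunctional K q hq)

/-- The duality on the tensor square of `K[x, y] / (x^q, y^q)`. -/
noncomputable def tensorDuality (q : ℕ) (hq : 0 < q) :
    PlaneQuotient K q ⊗[K] PlaneQuotient K q ≃ₗ[K]
      Module.Dual K (PlaneQuotient K q ⊗[K] PlaneQuotient K q) :=
  (TensorProduct.congr (planeDuality q hq) (planeDuality q hq)).trans
    (TensorProduct.dualDistribEquiv K (PlaneQuotient K q) (PlaneQuotient K q))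

theorem tensorDuality_apply (q : ℕ) (hq : 0 < q)
    (w w' : PlaneQuotient K q ⊗[K] PlaneQuotient K q) :
    tensorDuality q hq w w' = tensorFunctional q hq (w * w') := by
  suffices h : (tensorDuality q hq).toLinearMap =
      (LinearMap.mul K (PlaneQuotient K q ⊗[K] PlaneQuotient K q)).compr₂
        (tensorFunctional q hq) from
    LinearMap.congr_fun (LinearMap.congr_fun h w) w'
  refine TensorProduct.ext' fun a b => TensorProduct.ext' fun a' b' => ?_
  change (TensorProduct.dualDistrib K _ _ (planeDuality q hq a ⊗ₜ planeDuality q hq b)) (a' ⊗ₜ b') =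
    tensorFunctional q hq ((a ⊗ₜ b) * (a' ⊗ₜ b'))
  rw [TensorProduct.dualDistrib_apply, Algebra.TensorProduct.tmul_mul_tmul, planeDuality_apply,
    planeDuality_apply]
  rfl

variable (K) in
/-- The isomorphism `K[x, y] ⊗ K[x, y] ≃ K[x₁, x₂, x₃, x₄]`, as a homomorphism. -/
noncomputable def planeProduct :
    MvPolynomial (Fin 2) K ⊗[K] MvPolynomial (Fin 2) K →ₐ[K] MvPolynomial (Fin 4) K :=
  Algebra.TensorProduct.productMap (rename ![0, 1]) (rename ![2, 3])

theorem planeProduct_surjective : Function.Surjective (planeProduct K) := by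
  rw [← AlgHom.range_eq_top, eq_top_iff, ← MvPolynomial.adjoin_range_X, Algebra.adjoin_le_iff]
  rintro _ ⟨i, rfl⟩
  fin_cases i
  · exact ⟨X 0 ⊗ₜ 1, by simp [planeProduct]⟩
  · exact ⟨X 1 ⊗ₜ 1, by simp [planeProduct]⟩
  · exact ⟨1 ⊗ₜ X 0, by simp [planeProduct]⟩
  · exact ⟨1 ⊗ₜ X 1, by simp [planeProduct]⟩

variable (K) in
/-- The quotient map `K[x, y] ⊗ K[x, y] → K[x, y] / (x^q, y^q) ⊗ K[x, y] / (x^q, y^q)`. -/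
noncomputable def tensorQuotientMap (q : ℕ) :
    MvPolynomial (Fin 2) K ⊗[K] MvPolynomial (Fin 2) K →ₐ[K]
      PlaneQuotient K q ⊗[K] PlaneQuotient K q :=
  Algebra.TensorProduct.map (Ideal.Quotient.mkₐ K _) (Ideal.Quotient.mkₐ K _)

theorem tensorQuotientMap_surjective (q : ℕ) :
    Function.Surjective (tensorQuotientMap K q) :=
  TensorProduct.map_surjective (Ideal.Quotient.mkₐ_surjective K _)
    (Ideal.Quotient.mkₐ_surjective K _)

/-- On pairs of monomials, the four-variable exponent is the top one exactly when both two-variable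
exponents are. -/
theorem coeff_planeProduct (q : ℕ) (hq : 0 < q)
    (z : MvPolynomial (Fin 2) K ⊗[K] MvPolynomial (Fin 2) K) :
    coeff (topExponent (Fin 4) q) (planeProduct K z) =
      tensorFunctional q hq (tensorQuotientMap K q z) := by
  suffices h : lcoeff K (topExponent (Fin 4) q) ∘ₗ (planeProduct K).toLinearMap =
      tensorFunctional q hq ∘ₗ (tensorQuotientMap K q).toLinearMap from LinearMap.congr_fun h z
  refine TensorProduct.ext (MvPolynomial.linearMap_ext fun m => LinearMap.ext_ring
    (MvPolynomial.linearMap_ext fun n => LinearMap.ext_ring ?_))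
  change coeff (topExponent (Fin 4) q) (planeProduct K (monomial m 1 ⊗ₜ monomial n 1)) =
    coeff (topExponent (Fin 2) q) (monomial m 1) * coeff (topExponent (Fin 2) q) (monomial n 1)
  rw [planeProduct, Algebra.TensorProduct.productMap_apply_tmul, rename_monomial, rename_monomial,
    monomial_mul, coeff_monomial, coeff_monomial, coeff_monomial, one_mul, ite_zero_mul_ite_zero,
    one_mul]
  refine if_congr ?_ rfl rfl
  have h01 : Function.Injective (![0, 1] : Fin 2 → Fin 4) := by decide
  have h23 : Function.Injective (![2, 3] : Fin 2 → Fin 4) := by decide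
  have e0 := Finsupp.mapDomain_apply h01 m 0
  have e1 := Finsupp.mapDomain_apply h01 m 1
  have e2 := Finsupp.mapDomain_apply h23 n 0
  have e3 := Finsupp.mapDomain_apply h23 n 1
  have e0' := Finsupp.mapDomain_of_notMem_range (f := ![2, 3]) n (0 : Fin 4) (by decide)
  have e1' := Finsupp.mapDomain_of_notMem_range (f := ![2, 3]) n (1 : Fin 4) (by decide)
  have e2' := Finsupp.mapDomain_of_notMem_range (f := ![0, 1]) m (2 : Fin 4) (by decide)
  have e3' := Finsupp.mapDomain_of_notMem_range (f := ![0, 1]) m (3 : Fin 4) (by decide)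
  simp only [Matrix.cons_val_zero, Matrix.cons_val_one] at e0 e1 e2 e3
  rw [Finsupp.ext_iff, Finsupp.ext_iff, Finsupp.ext_iff, Fin.forall_fin_two, Fin.forall_fin_two]
  simp only [Finsupp.add_apply, topExponent_apply]
  constructor
  · intro h
    have h0 := h 0
    have h1 := h 1
    have h2 := h 2
    have h3 := h 3
    omega
  · rintro ⟨⟨h0, h1⟩, h2, h3⟩ i
    fin_cases i <;> dsimp <;> omega

theorem tensorQuotientMap_tmul_mul (q : ℕ) (a b : MvPolynomial (Fin 2) K)
    (w : PlaneQuotient K q ⊗[K] PlaneQuotient K q) :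
    tensorQuotientMap K q (a ⊗ₜ b) * w = TensorProduct.map
      (mulQuotient K (planeFrobeniusIdeal K q) a) (mulQuotient K (planeFrobeniusIdeal K q) b) w := by
  induction w using TensorProduct.induction_on with
  | zero => exact (mul_zero _).trans (map_zero _).symm
  | add c d hc hd =>
    rw [map_add, ← hc, ← hd]
    exact mul_add _ _ _
  | tmul c d =>
    rw [TensorProduct.map_tmul]
    exact Algebra.TensorProduct.tmul_mul_tmul _ _ _ _

theorem tensorQuotientMap_mul_eq_alternatingTensor (q : ℕ)
    (w : PlaneQuotient K q ⊗[K] PlaneQuotient K q) :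
    tensorQuotientMap K q (∑ s ∈ Finset.range q,
      (-1 : K) ^ s • ((planeCubic K ^ s) ⊗ₜ[K] (planeCubic K ^ (q - 1 - s)))) * w =
      alternatingTensor (mulQuotient K (planeFrobeniusIdeal K q) (planeCubic K)) q w := by
  rw [alternatingTensor, LinearMap.sum_apply, map_sum]
  refine (Finset.sum_mul (Finset.range q) (fun s => tensorQuotientMap K q
    ((-1 : K) ^ s • ((planeCubic K ^ s) ⊗ₜ[K] (planeCubic K ^ (q - 1 - s))))) w).trans
    (Finset.sum_congr rfl fun s _ => ?_)
  rw [LinearMap.smul_apply, mulQuotient_pow, mulQuotient_pow, ← tensorQuotientMap_tmul_mul,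
    map_smul]
  exact smul_mul_assoc _ _ _

/-- The Fermat cubic as a polynomial in four variables. -/
theorem fermatCubic_eq_planeProduct :
    fermatCubic K = ((planeProduct K (planeCubic K ⊗ₜ[K] 1) + planeProduct K (1 ⊗ₜ[K] planeCubic K) :
      MvPolynomial (Fin 4) K) : MvPowerSeries (Fin 4) K) := by
  simp [fermatCubic, planeProduct, Fin.sum_univ_succ, planeCubic]
  ring

/-- The top coefficient of f^(q-1) h r is the pairing of the alternating tensor sum applied to the
class of h with the class of r. Dual systems therefore detect the rank of that sum, which is the
convolution. -/
theorem exists_dual_system_fermatCubic_iff (p e : ℕ) [Fact p.Prime] [CharP K p] (hp : p ≠ 2)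
    (n : ℕ) :
    (∃ h r : Fin n → MvPowerSeries (Fin 4) K, ∀ i j,
      MvPowerSeries.coeff (topExponent (Fin 4) (p ^ e))
        (fermatCubic K ^ (p ^ e - 1) * h i * r j) = if i = j then 1 else 0) ↔
      n ≤ planeConvolution K (p ^ e) := by
  have hq : 0 < p ^ e := pow_pos (Fact.out : p.Prime).pos e
  set q := p ^ e with hqe
  have hnil : mulQuotient K (planeFrobeniusIdeal K q) (planeCubic K) ^ q = 0 := by
    rw [mulQuotient_pow, mulQuotient, Ideal.Quotient.eq_zero_iff_mem.mpr, LinearMap.mulLeft_zero_eq_zero]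
    rw [hqe, planeCubic, add_pow_char_pow, planeFrobeniusIdeal, Ideal.mem_span_pair]
    exact ⟨(X 0 ^ q) ^ 2, (X 1 ^ q) ^ 2, by ring⟩
  have hcount : planeConvolution K q = Module.finrank K (LinearMap.range
      (alternatingTensor (mulQuotient K (planeFrobeniusIdeal K q) (planeCubic K)) q)) := by
    rw [finrank_range_alternatingTensor hq hnil]
    rfl
  have hF : fermatCubic K ^ (q - 1) = ((planeProduct K (∑ s ∈ Finset.range q,
      (-1 : K) ^ s • ((planeCubic K ^ s) ⊗ₜ[K] (planeCubic K ^ (q - 1 - s)))) :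
        MvPolynomial (Fin 4) K) : MvPowerSeries (Fin 4) K) := by
    have hne : planeProduct K (planeCubic K ⊗ₜ[K] 1) + planeProduct K (1 ⊗ₜ[K] planeCubic K) ≠ 0 := by
      intro h0
      have h1 := congrArg (MvPolynomial.eval ![1, 0, 0, 0]) h0
      simp [planeProduct] at h1
    rw [fermatCubic_eq_planeProduct, ← MvPolynomial.coe_pow, hqe,
      ← sum_neg_one_pow_mul_eq_add_pow p e hp hne, map_sum]
    congr 1
    refine Finset.sum_congr rfl fun s _ => ?_
    rw [← map_pow, ← map_pow, ← map_mul, Algebra.TensorProduct.tmul_pow,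
      Algebra.TensorProduct.tmul_pow, Algebra.TensorProduct.tmul_mul_tmul, one_pow, one_pow,
      one_mul, mul_one, map_smul, Algebra.smul_def, map_pow, map_neg, map_one]
  have hkey : ∀ z z' : MvPolynomial (Fin 2) K ⊗[K] MvPolynomial (Fin 2) K,
      MvPowerSeries.coeff (topExponent (Fin 4) q) (fermatCubic K ^ (q - 1) *
        (planeProduct K z : MvPolynomial (Fin 4) K).toMvPowerSeries *
        (planeProduct K z' : MvPolynomial (Fin 4) K).toMvPowerSeries) =
      tensorDuality q hq (alternatingTensor
        (mulQuotient K (planeFrobeniusIdeal K q) (planeCubic K)) q (tensorQuotientMap K q z))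
        (tensorQuotientMap K q z') := by
    intro z z'
    rw [hF, ← MvPolynomial.coe_mul, ← MvPolynomial.coe_mul, MvPolynomial.coeff_coe, ← map_mul,
      ← map_mul, coeff_planeProduct q hq, tensorDuality_apply, map_mul (tensorQuotientMap K q),
      map_mul (tensorQuotientMap K q), tensorQuotientMap_mul_eq_alternatingTensor]
  rw [hcount, ← exists_dual_system_iff_le_finrank_range (tensorDuality q hq)
    (fun v w => by rw [tensorDuality_apply, tensorDuality_apply, mul_comm v w])]
  constructor
  · rintro ⟨h, r, hr⟩
    choose z hz using fun i => planeProduct_surjective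
      (MvPowerSeries.trunc' K (topExponent (Fin 4) q) (h i))
    choose z' hz' using fun i => planeProduct_surjective
      (MvPowerSeries.trunc' K (topExponent (Fin 4) q) (r i))
    refine ⟨fun i => tensorQuotientMap K q (z i), fun j => tensorQuotientMap K q (z' j), fun i j => ?_⟩
    -- The top coefficient sees only exponents at most q - 1, so power series may be replaced by
    -- polynomial truncations.
    have htop : ∀ u v w : MvPowerSeries (Fin 4) K,
        MvPowerSeries.coeff (topExponent (Fin 4) q) (u *
          (MvPowerSeries.trunc' K (topExponent (Fin 4) q) v).toMvPowerSeries * w) =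
        MvPowerSeries.coeff (topExponent (Fin 4) q) (u * v * w) := by
      intro u v w
      rw [mul_right_comm, mul_right_comm u v,
        ← MvPowerSeries.coeff_trunc'_mul_trunc'_eq_coeff_mul _ _ _ le_rfl,
        MvPowerSeries.trunc'_trunc' le_rfl,
        MvPowerSeries.coeff_trunc'_mul_trunc'_eq_coeff_mul _ _ _ le_rfl]
    rw [← hkey, hz, hz', ← hr, htop, mul_assoc, mul_comm (h i), ← mul_assoc, htop, mul_right_comm]
  · rintro ⟨h, r, hr⟩
    choose z hz using fun i => tensorQuotientMap_surjective q (h i)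
    choose z' hz' using fun i => tensorQuotientMap_surjective q (r i)
    refine ⟨fun i => (planeProduct K (z i) : MvPolynomial (Fin 4) K),
      fun j => (planeProduct K (z' j) : MvPolynomial (Fin 4) K), fun i j => ?_⟩
    rw [hkey, hz, hz', hr]

end PlaneForm

/-! ### Power series over their subring of q-th powers. -/

section FrobeniusComponent

open MvPowerSeries

variable {σ K : Type*} [Field K] (p e : ℕ) [Fact p.Prime] [CharP K p]

theorem coeff_smul_pow_pow (u : MvPowerSeries σ K) (n : σ →₀ ℕ) :
    coeff (p ^ e • n) (u ^ p ^ e) = coeff n u ^ p ^ e := by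
  rw [← map_iterateFrobenius_expand p (Fact.out : p.Prime).ne_zero, coeff_map, coeff_expand_smul,
    iterateFrobenius_def]

theorem coeff_pow_pow_of_not_dvd (u : MvPowerSeries σ K) {n : σ →₀ ℕ} {i : σ}
    (h : ¬ p ^ e ∣ n i) : coeff n (u ^ p ^ e) = 0 := by
  rw [← map_iterateFrobenius_expand p (Fact.out : p.Prime).ne_zero, coeff_map,
    coeff_expand_of_not_dvd _ _ _ h, map_zero]

theorem exists_smul_eq_of_forall_dvd {q : ℕ} {n : σ →₀ ℕ} (h : ∀ i, q ∣ n i) :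
    ∃ m : σ →₀ ℕ, q • m = n :=
  ⟨n.mapRange (· / q) (Nat.zero_div q), Finsupp.ext fun i => Nat.mul_div_cancel' (h i)⟩

theorem pow_p_pow_injective : Function.Injective fun x : K => x ^ p ^ e :=
  iterateFrobenius_inj K p e

variable [PerfectField K]

/-- The component `Φ_μ h` in the decomposition `h = ∑ x^μ (Φ_μ h)^q` of a power series with respect
to the basis of the monomials `x^μ`, `μ < q`, over the subring of `q`-th powers, `q = p ^ e`. -/
noncomputable def frobeniusComponent (μ : σ →₀ ℕ) : MvPowerSeries σ K →+ MvPowerSeries σ K where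
  toFun h := fun ν =>
    haveI := PerfectField.toPerfectRing (K := K) p
    (iterateFrobeniusEquiv K p e).symm (coeff (p ^ e • ν + μ) h)
  map_zero' := by
    funext ν
    exact map_zero _
  map_add' a b := by
    funext ν
    exact map_add _ _ _

theorem coeff_frobeniusComponent_pow (μ ν : σ →₀ ℕ) (h : MvPowerSeries σ K) :
    coeff ν (frobeniusComponent p e μ h) ^ p ^ e = coeff (p ^ e • ν + μ) h := by
  have := PerfectField.toPerfectRing (K := K) p
  exact (iterateFrobeniusEquiv K p e).apply_symm_apply _

/-- Only exponents divisible by q occur in u^q. The bound μ < q excludes a carry, so the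
contributing pairs of exponents are exactly those of the product on the right. -/
theorem frobeniusComponent_pow_mul {μ : σ →₀ ℕ} (hμ : ∀ i, μ i < p ^ e)
    (u h : MvPowerSeries σ K) :
    frobeniusComponent p e μ (u ^ p ^ e * h) = u * frobeniusComponent p e μ h := by
  classical
  ext ν
  apply pow_p_pow_injective p e
  change coeff ν (frobeniusComponent p e μ (u ^ p ^ e * h)) ^ p ^ e =
    coeff ν (u * frobeniusComponent p e μ h) ^ p ^ e
  have hq : 0 < p ^ e := pow_pos (Fact.out : p.Prime).pos e
  rw [coeff_frobeniusComponent_pow, coeff_mul, coeff_mul, sum_pow_char_pow]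
  symm
  refine Finset.sum_of_injOn (fun x => (p ^ e • x.1, p ^ e • x.2 + μ)) ?_ ?_ ?_ ?_
  · rintro ⟨a, b⟩ - ⟨a', b'⟩ - hab
    simp only [Prod.mk.injEq, add_left_inj] at hab
    exact Prod.ext (smul_right_injective _ hq.ne' hab.1) (smul_right_injective _ hq.ne' hab.2)
  · rintro ⟨a, b⟩ hab
    simp only [Finset.mem_coe, Finset.HasAntidiagonal.mem_antidiagonal] at hab ⊢
    rw [← hab, smul_add, add_assoc]
  · rintro ⟨a, b⟩ hab hnot
    rw [Finset.HasAntidiagonal.mem_antidiagonal] at hab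
    by_cases hd : ∀ i, p ^ e ∣ a i
    · exfalso
      obtain ⟨a', rfl⟩ := exists_smul_eq_of_forall_dvd hd
      have hle : a' ≤ ν := by
        intro i
        have h1 := DFunLike.congr_fun hab i
        have h2 := hμ i
        simp only [Finsupp.add_apply, Finsupp.smul_apply, smul_eq_mul] at h1
        by_contra! h3
        have h4 : p ^ e * (ν i + 1) ≤ p ^ e * a' i := Nat.mul_le_mul_left _ h3
        rw [mul_add] at h4
        omega
      obtain ⟨b', rfl⟩ := exists_add_of_le hle
      refine hnot ⟨(a', b'), Finset.mem_coe.mpr (Finset.HasAntidiagonal.mem_antidiagonal.mpr rfl), ?_⟩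
      rw [smul_add, add_assoc, add_right_inj] at hab
      exact Prod.ext rfl hab.symm
    · push Not at hd
      obtain ⟨i, hi⟩ := hd
      rw [coeff_pow_pow_of_not_dvd p e u hi, zero_mul]
  · rintro ⟨a, b⟩ -
    rw [mul_pow, coeff_frobeniusComponent_pow, coeff_smul_pow_pow]

theorem frobeniusComponent_monomial_mul (μ ν : σ →₀ ℕ) (h : MvPowerSeries σ K) :
    frobeniusComponent p e (ν + μ) (monomial ν 1 * h) = frobeniusComponent p e μ h := by
  ext n
  apply pow_p_pow_injective p e
  change coeff n _ ^ p ^ e = coeff n _ ^ p ^ e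
  rw [coeff_frobeniusComponent_pow, coeff_frobeniusComponent_pow, add_left_comm,
    coeff_add_monomial_mul, one_mul]

theorem frobeniusComponent_monomial_of_ne {μ ν : σ →₀ ℕ}
    (hν : ∀ i, ν i < p ^ e) (h : μ ≠ ν) :
    frobeniusComponent p e μ (monomial ν (1 : K)) = 0 := by
  classical
  ext n
  apply pow_p_pow_injective p e
  change coeff n _ ^ p ^ e = coeff n _ ^ p ^ e
  have hq : 0 < p ^ e := pow_pos (Fact.out : p.Prime).pos e
  rw [coeff_frobeniusComponent_pow, coeff_zero, zero_pow hq.ne', coeff_monomial, if_neg]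
  rintro rfl
  refine h (Finsupp.ext fun i => ?_)
  have h1 := hν i
  simp only [Finsupp.add_apply, Finsupp.smul_apply, smul_eq_mul] at h1 ⊢
  rcases Nat.eq_zero_or_pos (n i) with h2 | h2
  · rw [h2, mul_zero, zero_add]
  · have := Nat.le_mul_of_pos_right (p ^ e) h2
    omega

theorem frobeniusComponent_monomial_self (μ : σ →₀ ℕ) :
    frobeniusComponent p e μ (monomial μ (1 : K)) = 1 := by
  classical
  have hq : 0 < p ^ e := pow_pos (Fact.out : p.Prime).pos e
  ext n
  apply pow_p_pow_injective p e
  change coeff n _ ^ p ^ e = coeff n _ ^ p ^ e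
  rw [coeff_frobeniusComponent_pow, coeff_monomial, coeff_one]
  have : p ^ e • n + μ = μ ↔ n = 0 := by
    rw [add_eq_right, smul_eq_zero, or_iff_right hq.ne']
  rw [if_congr this rfl rfl]
  split_ifs
  · rw [one_pow]
  · rw [zero_pow hq.ne']

variable [Finite σ]

theorem topExponent_lt (i : σ) : topExponent σ (p ^ e) i < p ^ e := by
  have hq : 0 < p ^ e := pow_pos (Fact.out : p.Prime).pos e
  rw [topExponent_apply]
  omega

theorem le_topExponent_iff {μ : σ →₀ ℕ} : μ ≤ topExponent σ (p ^ e) ↔ ∀ i, μ i < p ^ e := by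
  have hq : 0 < p ^ e := pow_pos (Fact.out : p.Prime).pos e
  refine forall_congr' fun i => ?_
  rw [topExponent_apply]
  omega

/-- Every component is the top one after multiplication by a complementary monomial; the top
projection thus generates all the others. -/
theorem frobeniusComponent_eq_top {μ : σ →₀ ℕ} (hμ : μ ≤ topExponent σ (p ^ e))
    (h : MvPowerSeries σ K) :
    frobeniusComponent p e μ h = frobeniusComponent p e (topExponent σ (p ^ e))
      (monomial (topExponent σ (p ^ e) - μ) 1 * h) := by
  conv_rhs => rw [← tsub_add_cancel_of_le hμ, add_tsub_cancel_right]
  rw [frobeniusComponent_monomial_mul]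

theorem sum_monomial_mul_frobeniusComponent_pow [DecidableEq σ] (h : MvPowerSeries σ K) :
    ∑ μ ∈ Finset.Iic (topExponent σ (p ^ e)), monomial μ 1 * frobeniusComponent p e μ h ^ p ^ e =
      h := by
  classical
  have hq : 0 < p ^ e := pow_pos (Fact.out : p.Prime).pos e
  ext n
  let r : σ →₀ ℕ := n.mapRange (· % p ^ e) (Nat.zero_mod _)
  let d : σ →₀ ℕ := n.mapRange (· / p ^ e) (Nat.zero_div _)
  have hn : n = r + p ^ e • d := Finsupp.ext fun i => (Nat.mod_add_div (n i) (p ^ e)).symm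
  have hr : r ∈ Finset.Iic (topExponent σ (p ^ e)) := by
    rw [Finset.mem_Iic, le_topExponent_iff]
    exact fun i => Nat.mod_lt _ hq
  rw [map_sum, Finset.sum_eq_single_of_mem r hr]
  · rw [hn, coeff_add_monomial_mul, one_mul, coeff_smul_pow_pow, coeff_frobeniusComponent_pow,
      add_comm]
  · intro μ hμ hne
    rw [Finset.mem_Iic, le_topExponent_iff] at hμ
    rw [coeff_monomial_mul]
    split_ifs with hle
    · obtain ⟨i, hi⟩ : ∃ i, μ i ≠ r i := by
        by_contra! hcon
        exact hne (Finsupp.ext hcon)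
      rw [coeff_pow_pow_of_not_dvd p e (i := i), mul_zero]
      intro hdvd
      apply hi
      rw [Finsupp.tsub_apply] at hdvd
      exact (Nat.mod_eq_of_lt (hμ i)).symm.trans
        ((Nat.modEq_iff_dvd' (hle i)).mpr hdvd)
    · rfl

/-- A series is divisible by `f ^ q` if all its components are divisible by `f`. -/
theorem pow_dvd_of_forall_dvd_frobeniusComponent (f h : MvPowerSeries σ K)
    (hf : ∀ μ ≤ topExponent σ (p ^ e), f ∣ frobeniusComponent p e μ h) : f ^ p ^ e ∣ h := by
  classical
  rw [← sum_monomial_mul_frobeniusComponent_pow p e h]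
  exact Finset.dvd_sum fun μ hμ =>
    dvd_mul_of_dvd_right (pow_dvd_pow_of_dvd (hf μ (Finset.mem_Iic.mp hμ)) _) _

/-- Every choice of values `c μ` on the monomials `x^μ`, `μ < q`, is obtained by multiplying with a
fixed series and projecting onto the component of the top monomial. -/
theorem frobeniusComponent_topExponent_sum [DecidableEq σ]
    (c : (σ →₀ ℕ) → MvPowerSeries σ K)
    {μ : σ →₀ ℕ} (hμ : μ ≤ topExponent σ (p ^ e)) :
    frobeniusComponent p e (topExponent σ (p ^ e))
      ((∑ ν ∈ Finset.Iic (topExponent σ (p ^ e)),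
        c ν ^ p ^ e * monomial (topExponent σ (p ^ e) - ν) 1) * monomial μ 1) = c μ := by
  rw [Finset.sum_mul, map_sum, Finset.sum_eq_single_of_mem μ (Finset.mem_Iic.mpr hμ)]
  · rw [mul_assoc, frobeniusComponent_pow_mul p e (topExponent_lt p e),
      ← frobeniusComponent_eq_top p e hμ, frobeniusComponent_monomial_self, mul_one]
  · intro ν hν hne
    rw [Finset.mem_Iic] at hν
    rw [mul_assoc, frobeniusComponent_pow_mul p e (topExponent_lt p e),
      ← frobeniusComponent_eq_top p e hν, frobeniusComponent_monomial_of_ne p e _ hne, mul_zero]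
    exact (le_topExponent_iff p e).mp hμ

end FrobeniusComponent

/-! ### Linear maps out of R^{1/q} and free summands. -/

section FreeSummand

open MvPowerSeries

variable {σ K : Type*} [Finite σ] [Field K] (p e : ℕ) [Fact p.Prime] [CharP K p] [PerfectField K]
  {f : MvPowerSeries σ K}

/-- Changing r by a multiple of f changes the argument by a multiple of f^q, whose component is a
multiple of f. The formula therefore descends to the quotient. -/
theorem exists_linearMap_frobeniusRoot [ExpChar (MvPowerSeries σ K ⧸ Ideal.span {f}) p]
    (h : MvPowerSeries σ K) :
    ∃ φ : FrobeniusRoot (MvPowerSeries σ K ⧸ Ideal.span {f}) p e →ₗ[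
        MvPowerSeries σ K ⧸ Ideal.span {f}] MvPowerSeries σ K ⧸ Ideal.span {f},
      ∀ r, φ (FrobeniusRoot.root _ p e (Ideal.Quotient.mk _ r)) = Ideal.Quotient.mk _
        (frobeniusComponent p e (topExponent σ (p ^ e)) (f ^ (p ^ e - 1) * h * r)) := by
  have hq : 0 < p ^ e := pow_pos (Fact.out : p.Prime).pos e
  have hwd : ∀ r r', Ideal.Quotient.mk (Ideal.span {f}) r = Ideal.Quotient.mk (Ideal.span {f}) r' →
      Ideal.Quotient.mk (Ideal.span {f})
        (frobeniusComponent p e (topExponent σ (p ^ e)) (f ^ (p ^ e - 1) * h * r)) =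
      Ideal.Quotient.mk (Ideal.span {f})
        (frobeniusComponent p e (topExponent σ (p ^ e)) (f ^ (p ^ e - 1) * h * r')) := by
    intro r r' hr
    rw [Ideal.Quotient.mk_eq_mk_iff_sub_mem, Ideal.mem_span_singleton] at hr ⊢
    obtain ⟨u, hu⟩ := hr
    have : f ^ (p ^ e - 1) * h * r - f ^ (p ^ e - 1) * h * r' = f ^ p ^ e * (h * u) := by
      rw [← mul_sub, hu]
      conv_rhs => rw [← Nat.sub_add_cancel hq]
      ring
    rw [← map_sub, this, frobeniusComponent_pow_mul p e (topExponent_lt p e)]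
    exact dvd_mul_right _ _
  have hsurj := Ideal.Quotient.mk_surjective (I := Ideal.span {f})
  let g : FrobeniusRoot (MvPowerSeries σ K ⧸ Ideal.span {f}) p e →
      MvPowerSeries σ K ⧸ Ideal.span {f} := fun x => Ideal.Quotient.mk _
        (frobeniusComponent p e (topExponent σ (p ^ e))
          (f ^ (p ^ e - 1) * h * Function.surjInv hsurj x))
  have hg : ∀ r, g (FrobeniusRoot.root _ p e (Ideal.Quotient.mk _ r)) = Ideal.Quotient.mk _
      (frobeniusComponent p e (topExponent σ (p ^ e)) (f ^ (p ^ e - 1) * h * r)) := fun r =>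
    hwd _ _ (Function.surjInv_eq hsurj _)
  refine ⟨{ toFun := g, map_add' := ?_, map_smul' := ?_ }, hg⟩
  · intro x y
    obtain ⟨r, rfl⟩ := hsurj x
    obtain ⟨s, rfl⟩ := hsurj y
    refine (hg (r + s)).trans ?_
    rw [mul_add, map_add, map_add]
    exact congrArg₂ _ (hg r).symm (hg s).symm
  · intro c x
    obtain ⟨r, rfl⟩ := hsurj x
    obtain ⟨u, rfl⟩ := hsurj c
    refine (hg (u ^ p ^ e * r)).trans ?_
    rw [mul_left_comm, frobeniusComponent_pow_mul p e (topExponent_lt p e), map_mul]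
    exact congrArg _ (hg r).symm

/-- The values of φ on the monomials below q lift φ to the top projection after multiplication by a
series H. As φ vanishes on the ideal of f, all components of H f are divisible by f, so f^q ∣ H f
and f^(q-1) ∣ H. -/
theorem exists_eq_frobeniusComponent_of_linearMap
    [ExpChar (MvPowerSeries σ K ⧸ Ideal.span {f}) p] (hf : f ≠ 0)
    (φ : FrobeniusRoot (MvPowerSeries σ K ⧸ Ideal.span {f}) p e →ₗ[
        MvPowerSeries σ K ⧸ Ideal.span {f}] MvPowerSeries σ K ⧸ Ideal.span {f}) :
    ∃ h : MvPowerSeries σ K, ∀ r, φ (FrobeniusRoot.root _ p e (Ideal.Quotient.mk _ r)) =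
      Ideal.Quotient.mk _
        (frobeniusComponent p e (topExponent σ (p ^ e)) (f ^ (p ^ e - 1) * h * r)) := by
  classical
  have hq : 0 < p ^ e := pow_pos (Fact.out : p.Prime).pos e
  choose c hc using fun μ : σ →₀ ℕ => Ideal.Quotient.mk_surjective
    (φ (FrobeniusRoot.root _ p e (Ideal.Quotient.mk _ (monomial μ 1))))
  set H := ∑ ν ∈ Finset.Iic (topExponent σ (p ^ e)),
    c ν ^ p ^ e * monomial (topExponent σ (p ^ e) - ν) 1 with hH
  have hsmul : ∀ u r : MvPowerSeries σ K,
      φ (FrobeniusRoot.root _ p e (Ideal.Quotient.mk _ (u ^ p ^ e * r))) =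
        Ideal.Quotient.mk _ u * φ (FrobeniusRoot.root _ p e (Ideal.Quotient.mk _ r)) := fun u r =>
    φ.map_smul (Ideal.Quotient.mk _ u) (FrobeniusRoot.root _ p e (Ideal.Quotient.mk _ r))
  have hadd : ∀ (s : Finset (σ →₀ ℕ)) (u : (σ →₀ ℕ) → MvPowerSeries σ K),
      φ (FrobeniusRoot.root _ p e (Ideal.Quotient.mk _ (∑ μ ∈ s, u μ))) =
        ∑ μ ∈ s, φ (FrobeniusRoot.root _ p e (Ideal.Quotient.mk _ (u μ))) := by
    intro s u
    rw [map_sum]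
    exact map_sum φ (fun μ => FrobeniusRoot.root _ p e (Ideal.Quotient.mk _ (u μ))) s
  have hφ : ∀ r, φ (FrobeniusRoot.root _ p e (Ideal.Quotient.mk _ r)) =
      Ideal.Quotient.mk _ (frobeniusComponent p e (topExponent σ (p ^ e)) (H * r)) := by
    intro r
    conv_lhs => rw [← sum_monomial_mul_frobeniusComponent_pow p e r]
    conv_rhs => rw [← sum_monomial_mul_frobeniusComponent_pow p e r]
    rw [hadd, Finset.mul_sum, map_sum, map_sum]
    refine Finset.sum_congr rfl fun μ hμ => ?_
    rw [mul_comm (monomial μ (1 : K)), hsmul, mul_left_comm,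
      frobeniusComponent_pow_mul p e (topExponent_lt p e),
      frobeniusComponent_topExponent_sum p e c (Finset.mem_Iic.mp hμ), map_mul, hc]
  have hdvd : ∀ u, f ∣ frobeniusComponent p e (topExponent σ (p ^ e)) (H * (f * u)) := by
    intro u
    rw [← Ideal.mem_span_singleton, ← Ideal.Quotient.eq_zero_iff_mem, ← hφ,
      Ideal.Quotient.eq_zero_iff_mem.mpr (Ideal.mem_span_singleton.mpr (dvd_mul_right f u))]
    exact φ.map_zero
  have hfq : f ^ p ^ e ∣ H * f := by
    refine pow_dvd_of_forall_dvd_frobeniusComponent p e f _ fun μ hμ => ?_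
    rw [frobeniusComponent_eq_top p e hμ]
    convert hdvd (monomial (topExponent σ (p ^ e) - μ) 1) using 2
    ring
  obtain ⟨h, hh⟩ : f ^ (p ^ e - 1) ∣ H := by
    rw [← Nat.sub_add_cancel hq, pow_succ] at hfq
    exact (mul_dvd_mul_iff_right hf).mp hfq
  exact ⟨h, fun r => by rw [hφ, hh]⟩

/-- R is local with residue field K, and the constant term of a top component is the q-th root of
the top coefficient. Surjectivity onto R^n yields the identity matrix of top coefficients;
conversely, a matrix reducing to the identity over K is invertible over R. -/
theorem hasFreeSummand_frobeniusRoot_iff [ExpChar (MvPowerSeries σ K ⧸ Ideal.span {f}) p]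
    (hf : f ≠ 0) (hf0 : constantCoeff f = 0) (n : ℕ) :
    HasFreeSummand (MvPowerSeries σ K ⧸ Ideal.span {f})
      (FrobeniusRoot (MvPowerSeries σ K ⧸ Ideal.span {f}) p e) n ↔
    ∃ h r : Fin n → MvPowerSeries σ K, ∀ i j,
      coeff (topExponent σ (p ^ e)) (f ^ (p ^ e - 1) * h i * r j) = if i = j then 1 else 0 := by
  have hq : 0 < p ^ e := pow_pos (Fact.out : p.Prime).pos e
  obtain ⟨ρ, hρ⟩ : ∃ ρ : (MvPowerSeries σ K ⧸ Ideal.span {f}) →+* K,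
      ∀ u, ρ (Ideal.Quotient.mk _ u) = constantCoeff u :=
    ⟨Ideal.Quotient.lift _ constantCoeff fun u hu => by
      obtain ⟨v, rfl⟩ := Ideal.mem_span_singleton.mp hu
      rw [map_mul, hf0, zero_mul], fun _ => rfl⟩
  have hunit : ∀ x, ρ x ≠ 0 → IsUnit x := by
    intro x hx
    obtain ⟨u, rfl⟩ := Ideal.Quotient.mk_surjective x
    rw [hρ] at hx
    exact (isUnit_iff_constantCoeff.mpr (isUnit_iff_ne_zero.mpr hx)).map _
  have hconst : ∀ u : MvPowerSeries σ K,
      constantCoeff (frobeniusComponent p e (topExponent σ (p ^ e)) u) ^ p ^ e =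
        coeff (topExponent σ (p ^ e)) u := by
    intro u
    rw [← coeff_zero_eq_constantCoeff_apply, coeff_frobeniusComponent_pow, smul_zero, zero_add]
  have hdelta : ∀ (i j : Fin n), (if i = j then (1 : K) else 0) ^ p ^ e = if i = j then 1 else 0 := by
    intro i j
    split_ifs
    · rw [one_pow]
    · rw [zero_pow hq.ne']
  rw [hasFreeSummand_iff_exists_surjective]
  constructor
  · rintro ⟨g, hg⟩
    choose h hh using fun i => exists_eq_frobeniusComponent_of_linearMap p e hf
      (LinearMap.proj i ∘ₗ g)
    choose x hx using fun j : Fin n => hg (Pi.single j 1)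
    choose r hr using fun j => Ideal.Quotient.mk_surjective (I := Ideal.span {f}) (x j)
    refine ⟨h, r, fun i j => ?_⟩
    have h1 := hh i (r j)
    rw [hr] at h1
    have h2 : g (FrobeniusRoot.root _ p e (x j)) = Pi.single j 1 := hx j
    rw [LinearMap.comp_apply, h2, LinearMap.proj_apply, Pi.single_apply] at h1
    rw [← hconst, ← hρ, ← h1, apply_ite ρ, map_one, map_zero, hdelta]
  · rintro ⟨h, r, hr⟩
    choose φ hφ using fun i => exists_linearMap_frobeniusRoot (f := f) p e (h i)
    let x : Fin n → FrobeniusRoot (MvPowerSeries σ K ⧸ Ideal.span {f}) p e := fun j =>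
      FrobeniusRoot.root _ p e (Ideal.Quotient.mk _ (r j))
    let M : Matrix (Fin n) (Fin n) (MvPowerSeries σ K ⧸ Ideal.span {f}) :=
      Matrix.of fun i j => φ i (x j)
    have hM : ρ.mapMatrix M = 1 := by
      ext i j
      apply pow_p_pow_injective p e
      change ρ (φ i (x j)) ^ p ^ e = (1 : Matrix (Fin n) (Fin n) K) i j ^ p ^ e
      rw [hφ, hρ, hconst, hr, Matrix.one_apply, hdelta]
    have hdet : IsUnit M.det := hunit _ (by rw [RingHom.map_det, hM, Matrix.det_one]; exact one_ne_zero)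
    refine ⟨LinearMap.pi φ, fun y => ⟨∑ j, (M⁻¹.mulVec y) j • x j, funext fun i => ?_⟩⟩
    rw [LinearMap.pi_apply, map_sum]
    calc ∑ j, φ i ((M⁻¹.mulVec y) j • x j) = M.mulVec (M⁻¹.mulVec y) i := by
          refine Finset.sum_congr rfl fun j _ => ?_
          rw [map_smul, smul_eq_mul, mul_comm]
          rfl
      _ = y i := by
          rw [Matrix.mulVec_mulVec, Matrix.mul_nonsing_inv _ hdet, Matrix.one_mulVec]

end FreeSummand

/-! ### Krull dimension. -/

theorem PowerSeries.ringKrullDim_eq_add_one (R : Type*) [CommRing R] [IsNoetherianRing R]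
    [IsLocalRing R] : ringKrullDim (PowerSeries R) = ringKrullDim R + 1 := by
  have hX : (PowerSeries.X : PowerSeries R) ∈ Ring.jacobson (PowerSeries R) := by
    rw [IsLocalRing.ringJacobson_eq_maximalIdeal, IsLocalRing.mem_maximalIdeal, mem_nonunits_iff,
      PowerSeries.isUnit_iff_constantCoeff, PowerSeries.constantCoeff_X]
    exact not_isUnit_zero
  have hreg : IsSMulRegular (PowerSeries R) (PowerSeries.X : PowerSeries R) := fun a b hab =>
    PowerSeries.X_mul_cancel hab
  have hker : RingHom.ker (PowerSeries.constantCoeff (R := R)) = Ideal.span {PowerSeries.X} := by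
    ext a
    rw [RingHom.mem_ker, Ideal.mem_span_singleton, PowerSeries.X_dvd_iff]
  have e := RingHom.quotientKerEquivOfSurjective (PowerSeries.constantCoeff_surj (R := R))
  rw [← ringKrullDim_quotient_span_singleton_succ_eq_ringKrullDim_of_mem_jacobson hreg hX, ← hker,
    ringKrullDim_eq_of_ringEquiv e]

section Dimension

open MvPowerSeries

variable (K : Type*) [Field K]

theorem ringKrullDim_mvPowerSeries_fin (n : ℕ) :
    ringKrullDim (MvPowerSeries (Fin n) K) = n := by
  induction n with
  | zero =>
    rw [ringKrullDim_eq_of_ringEquiv (isEmptyEquiv (Fin 0) K).toRingEquiv,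
      ringKrullDim_eq_zero_of_field, Nat.cast_zero]
  | succ n ih =>
    rw [ringKrullDim_eq_of_ringEquiv (finSuccEquiv K n).toRingEquiv,
      PowerSeries.ringKrullDim_eq_add_one, ih, Nat.cast_add, Nat.cast_one]

theorem fermatCubic_ne_zero : fermatCubic K ≠ 0 := by
  intro h
  have := congrArg (coeff (Finsupp.single (0 : Fin 4) 3)) h
  simp [fermatCubic, Fin.sum_univ_succ, coeff_X_pow, Finsupp.single_left_inj] at this

theorem constantCoeff_fermatCubic : constantCoeff (fermatCubic K) = 0 := by
  simp [fermatCubic]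

theorem ringKrullDim_fermatCubicRing : ringKrullDim (FermatCubicRing K) = 3 := by
  have hmem : fermatCubic K ∈ Ring.jacobson (MvPowerSeries (Fin 4) K) := by
    rw [IsLocalRing.ringJacobson_eq_maximalIdeal, IsLocalRing.mem_maximalIdeal, mem_nonunits_iff,
      isUnit_iff_constantCoeff, constantCoeff_fermatCubic]
    exact not_isUnit_zero
  have hreg : IsSMulRegular (MvPowerSeries (Fin 4) K) (fermatCubic K) := fun a b hab =>
    mul_left_cancel₀ (fermatCubic_ne_zero K) hab
  have h := ringKrullDim_quotient_span_singleton_succ_eq_ringKrullDim_of_mem_jacobson hreg hmem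
  rw [ringKrullDim_mvPowerSeries_fin] at h
  have h4 : ((4 : ℕ) : WithBot ℕ∞) = 3 + 1 := by norm_num
  rw [h4] at h
  exact ENat.WithBot.add_one_cancel.mp h

end Dimension

/-! ### Solving the recursion. -/

theorem FSignatureFunction_fermatCubicRing (K : Type*) [Field K] [PerfectField K] (p e : ℕ)
    [Fact p.Prime] [CharP K p] (hp : p ≠ 2) :
    FSignatureFunction p (FermatCubicRing K) e = planeConvolution K (p ^ e) := by
  have : {n | HasFreeSummand (FermatCubicRing K) (FrobeniusRoot (FermatCubicRing K) p e) n} =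
      Set.Iic (planeConvolution K (p ^ e)) := by
    ext n
    rw [Set.mem_ofPred_eq, Set.mem_Iic, hasFreeSummand_frobeniusRoot_iff p e
      (fermatCubic_ne_zero K) (constantCoeff_fermatCubic K),
      exists_dual_system_fermatCubic_iff p e hp]
  rw [FSignatureFunction, freeRank, this, csSup_Iic]

theorem planeConvolution_one {K : Type*} [Field K] {p d₀ m : ℕ}
    (h : FrobeniusParameters K p d₀ m 1) : planeConvolution K 1 = 1 := by
  have := h.sum_planeCount
  rw [Finset.sum_range_one] at this
  rw [planeConvolution, Finset.sum_range_one, this]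

/-- The condition on s makes s q^3 a particular solution of the recursion; the value 1 at q = 1
fixes the coefficient 1 - s of the homogeneous solution λ^e. -/
theorem planeConvolution_pow_eq {K : Type*} [Field K] {p d₀ m : ℕ}
    (h : ∀ e, FrobeniusParameters K p d₀ m (p ^ e)) {s lam : ℝ} (hlam : lam = (m : ℝ) + 2 - d₀)
    (hs : s * ((p : ℝ) ^ 3 - lam) = ((p : ℝ) ^ 3 - p) / 8) (e : ℕ) :
    (planeConvolution K (p ^ e) : ℝ) = s * (p : ℝ) ^ (3 * e) + (1 - s) * lam ^ e := by
  induction e with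
  | zero =>
    rw [pow_zero, planeConvolution_one (h 0)]
    simp
  | succ e ih =>
    have h1 : 8 * (planeConvolution K (p * p ^ e) : ℝ) =
        8 * (m + 2 - d₀) * planeConvolution K (p ^ e) + ((p ^ e : ℕ) : ℝ) ^ 3 * ((p : ℝ) ^ 3 - p) :=
      by exact_mod_cast planeConvolution_mul_p (h e)
    rw [← pow_succ', ih, ← hlam] at h1
    have h2 : (p : ℝ) ^ (3 * (e + 1)) = (p : ℝ) ^ (3 * e) * (p : ℝ) ^ 3 := by ring
    have h3 : ((p ^ e : ℕ) : ℝ) ^ 3 = (p : ℝ) ^ (3 * e) := by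
      push_cast
      ring
    rw [h3] at h1
    rw [h2, pow_succ lam]
    linear_combination h1 / 8 - (p : ℝ) ^ (3 * e) * hs

theorem theorem6p1 (p : ℕ) [Fact p.Prime] (hp : 3 < p)
    (K : Type*) [Field K] [CharP K p] [PerfectField K]
    (α : ℕ) (hα : α = if p % 3 = 1 then 0 else 1)
    (s : ℝ) (hs : s = 3 * (p : ℝ) * ((p : ℝ) - 1) * ((p : ℝ) + 1) /
      (8 * (3 * (p : ℝ) ^ 3 - (p : ℝ) + 2 * (-1) ^ (α + 1)))) :
    HasFSignature p (FermatCubicRing K) s ∧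
    (∀ e : ℕ, 1 ≤ e →
      (FSignatureFunction p (FermatCubicRing K) e : ℝ) =
        s * (p : ℝ) ^ (3 * e) + (1 - s) * (((p : ℝ) + 2 * (-1) ^ α) / 3) ^ e) ∧
    s < 1 / 8 := by
  have hprime : p.Prime := Fact.out
  have hp3 : (3 : ℝ) < p := by exact_mod_cast hp
  -- Here d₀ is the residue of p modulo 3 and ε = (-1)^α. In both cases (p + 2ε)/3 is the number m +
  -- 2 - d₀ of surviving strips.
  obtain ⟨d₀, m, hd, hpm, ε, hε, hε1, hlam⟩ : ∃ d₀ m : ℕ, (d₀ = 1 ∨ d₀ = 2) ∧ p = d₀ + 3 * m ∧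
      ∃ ε : ℝ, (-1) ^ α = ε ∧ (ε = 1 ∨ ε = -1) ∧ ((p : ℝ) + 2 * ε) / 3 = (m : ℝ) + 2 - d₀ := by
    by_cases h1 : p % 3 = 1
    · have h2 : p = 1 + 3 * (p / 3) := by omega
      refine ⟨1, p / 3, Or.inl rfl, h2, 1, by simp [hα, h1], Or.inl rfl, ?_⟩
      have h3 : (p : ℝ) = 1 + 3 * ((p / 3 : ℕ) : ℝ) := by exact_mod_cast h2
      rw [Nat.cast_one]
      linarith
    · have h0 : p % 3 ≠ 0 := fun h => by
        have := (Nat.prime_dvd_prime_iff_eq Nat.prime_three hprime).mp (Nat.dvd_of_mod_eq_zero h)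
        omega
      have h2 : p = 2 + 3 * (p / 3) := by omega
      refine ⟨2, p / 3, Or.inr rfl, h2, -1, by simp [hα, h1], Or.inr rfl, ?_⟩
      have h3 : (p : ℝ) = 2 + 3 * ((p / 3 : ℕ) : ℝ) := by exact_mod_cast h2
      rw [Nat.cast_two]
      linarith
  rw [pow_succ (-1 : ℝ) α, hε] at hs
  rw [hε]
  set lam : ℝ := ((p : ℝ) + 2 * ε) / 3 with hlamdef
  have hpar : ∀ e, FrobeniusParameters K p d₀ m (p ^ e) := fun e =>
    ⟨hprime, inferInstance, hd, hpm, by omega, e, rfl⟩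
  have hεle : -1 ≤ ε ∧ ε ≤ 1 := by rcases hε1 with rfl | rfl <;> norm_num
  have hcube : (p : ℝ) ^ 2 * 3 < (p : ℝ) ^ 3 := by
    rw [pow_succ (p : ℝ) 2]
    gcongr
  have hsq : (p : ℝ) * 3 < (p : ℝ) ^ 2 := by
    rw [sq]
    gcongr
  have hden : 0 < 3 * (p : ℝ) ^ 3 - p + 2 * (ε * -1) := by linarith
  have hsmul : s * ((p : ℝ) ^ 3 - lam) = ((p : ℝ) ^ 3 - p) / 8 := by
    rw [hs, hlamdef, div_mul_eq_mul_div, div_eq_iff (mul_ne_zero (by norm_num) hden.ne')]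
    ring
  have hFS : ∀ e, (FSignatureFunction p (FermatCubicRing K) e : ℝ) =
      s * (p : ℝ) ^ (3 * e) + (1 - s) * lam ^ e := by
    intro e
    rw [FSignatureFunction_fermatCubicRing K p e (by omega)]
    exact planeConvolution_pow_eq hpar hlam hsmul e
  refine ⟨⟨3, ringKrullDim_fermatCubicRing K, ?_⟩, fun e _ => hFS e, ?_⟩
  · refine IsBigO.of_bound |1 - s| (Eventually.of_forall fun e => ?_)
    have h1 : (p : ℝ) ^ ((((3 : ℕ) : ℤ) - 1) * (e : ℤ)) = ((p : ℝ) ^ 2) ^ e := by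
      rw [zpow_mul, zpow_natCast]
      norm_num
    have h2 : 0 ≤ lam := by
      rw [hlamdef]
      linarith
    rw [hFS, add_sub_cancel_left, h1, norm_mul, Real.norm_eq_abs, Real.norm_of_nonneg (by positivity),
      Real.norm_of_nonneg (by positivity)]
    gcongr
    rw [hlamdef]
    linarith
  · rw [hs, div_lt_iff₀ (by linarith)]
    nlinarith
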